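/- \textbf{Setting.} For a $3\times 3$ matrix $A=(a_{ij})$ of non-negative integers let $W=W_A=\sum_i\prod_j x_j^{a_{ij}}\in\mathbb{C}[x_0,x_1,x_2]$ (three monomials, all coefficients equal to one). Assume $A$ is invertible over $\mathbb{Q}$, put $q=A^{-1}\mathbf 1$, let $d$ be the least positive integer with $w:=dq$ integral, and assume: all $w_i>0$; $w$ is normalized, i.e. any two of the $w_i$ are coprime; $W$ is non-degenerate, i.e. the affine cone $\{W=0\}\subset\mathbb{C}^3$ is smooth outside the origin; and $w_0+w_1+w_2=d$. Call such an $A$ (or $W$) admissible. Let $X_W=\{W=0\}\subset\mathbb{P}(w)=\mathbb{P}(w_0,w_1,w_2)$ (an elliptic curve), let $\mathrm{SL}(W)$ be the group of diagonal linear maps of determinant one leaving $W$ invariant, $J_W\subset \mathrm{SL}(W)$ the subgroup acting trivially on $\mathbb{P}(w)$, and $\widetilde{\mathrm{SL}}(W)=\mathrm{SL}(W)/J_W$, which acts on $X_W$. Quotients by finite groups and isomorphisms are those of algebraic varieties. \textbf{Theorem.} (a) If $W$ is admissible and of the form $W=x_0^2+f(x_1,x_2)$, and $E=X_W$, then $E/\widetilde{\mathrm{SL}}(W)\cong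 E$. (b) The following thirteen potentials are admissible, with the stated weights and group orders: $$ \begin{array}{r|l|l|c|c|c|c} \text{No.}&w&W&|J_W|&|\mathrm{SL}(W)|&|\widetilde{\mathrm{SL}}(W)|&\text{mirror}\\ \hline 1&(1,1,1)&x_0^3+x_1^3+x_2^3&3&9&3&1\\ 2&(1,1,1)&x_0^2x_1+x_1^2x_2+x_2^3&3&3&1&7\\ 3&(1,1,1)&x_0^2x_1+x_1^2x_2+x_2^2x_0&3&3&1&3\\ 4&(1,1,1)&x_0^3+x_1^2x_2+x_2^3&3&3&1&13\\ 5&(1,1,1)&x_0^3+x_1^2x_2+x_2^2x_1&3&3&1&5\\ 6&(2,1,1)&x_0^2+x_1^4+x_2^4&4&8&2&6\\ 7&(2,1,1)&x_0^2+x_0x_1^2+x_1x_2^3&4&4&1&2\\ 8&(2,1,1)&x_0^2+x_1^3x_2+x_2^4&4&4&1&12\\ 9&(2,1,1)&x_0^2+x_0x_1^2+x_2^4&4&4&1&9\\ 10&(2,1,1)&x_0^2+x_1^3x_2+x_2^3x_1&4&4&1&10\\ 11&(3,2,1)&x_0^2+x_1^3+x_2^6&6&6&1&11\\ 12&(3,2,1)&x_0^2+x_1^3+x_1x_2^4&6&6&1&8\\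 13&(3,2,1)&x_0^2+x_0x_2^3+x_1^3&6&6&1&4 \end{array} $$ (c) Every admissible potential coincides, after a permutation of the variables, with exactly one of these thirteen. (d) For each of the thirteen, the transposed potential $W_{A^{\top}}$ (which defines its Berglund--H\"ubsch--Chiodo--Ruan mirror) coincides, after a permutation of the variables, with the potential whose number is in the last column. (e) For No. 1 and any primitive cube root of unity $\zeta$, the group $\widetilde{\mathrm{SL}}(W)$ is generated by the class of $\varphi=\mathrm{diag}(\zeta^2,\zeta,1)$, and $X_W/\langle\varphi\rangle$ is isomorphic to the curve No. 5. (f) For No. 6, $\widetilde{\mathrm{SL}}(W)$ is generated by the class of $\iota=\mathrm{diag}(-1,1,-1)$, and $X_W/\langle\iota\rangle$ is isomorphic to the curve No. 2. -/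

import Mathlib

open MvPolynomial TopologicalSpace

noncomputable section

namespace Delsarte

/-! ### Varieties as spaces with a sheaf of complex-valued regular functions -/

/-- A topological space together with a sheaf of `ℂ`-algebras of complex-valued functions,
called regular functions. -/
structure FunctionSpace where
  /-- the underlying topological space -/
  space : TopCat.{0}
  /-- the sheaf of regular functions, as a local predicate on functions on open subsets -/
  regular : TopCat.LocalPredicate (fun _ : space => ℂ)
  const_mem : ∀ (U : Opens space) (c : ℂ), regular.pred (U := U) (fun _ => c)
  add_mem : ∀ {U : Opens space} {f g : U → ℂ}, regular.pred f → regular.pred g →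
    regular.pred (fun x : U => f x + g x)
  mul_mem : ∀ {U : Opens space} {f g : U → ℂ}, regular.pred f → regular.pred g →
    regular.pred (fun x : U => f x * g x)

/-- An isomorphism of spaces with functions: a homeomorphism under which the regular functions
on every open subset correspond. -/
structure FunctionSpace.Iso (X Y : FunctionSpace) where
  toHomeomorph : X.space ≃ₜ Y.space
  regular_iff : ∀ (U : Opens Y.space) (f : U → ℂ),
    Y.regular.pred f ↔
      X.regular.pred (U := Opens.comap (toHomeomorph : C(X.space, Y.space)) U)
        (fun x => f ⟨toHomeomorph x.1, x.2⟩)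

/-- The quotient `X / G`: the set of orbits, with the quotient topology; a function on an open
subset of `X / G` is regular iff its pull-back to `X` is regular. -/
def FunctionSpace.quotient (X : FunctionSpace) (G : Type) [Group G] [MulAction G X.space] :
    FunctionSpace where
  space := TopCat.of (MulAction.orbitRel.Quotient G X.space)
  regular :=
    { pred := fun {U} f => X.regular.pred
        (U := Opens.comap ⟨fun x => (Quotient.mk'' x : MulAction.orbitRel.Quotient G X.space),
          continuous_quotient_mk'⟩ U)
        (fun x => f ⟨Quotient.mk'' x.1, x.2⟩)
      res := fun {U V} i f h => X.regular.res (CategoryTheory.homOfLE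
        (Opens.comap_mono _ (CategoryTheory.leOfHom i))) _ h
      locality := fun {U} f w => X.regular.locality _ fun x => by
        obtain ⟨V, hV, i, h⟩ := w ⟨Quotient.mk'' x.1, x.2⟩
        exact ⟨Opens.comap ⟨_, continuous_quotient_mk'⟩ V, hV,
          CategoryTheory.homOfLE (Opens.comap_mono _ (CategoryTheory.leOfHom i)), h⟩ }
  const_mem := fun _ c => X.const_mem _ c
  add_mem := fun hf hg => X.add_mem hf hg
  mul_mem := fun hf hg => X.mul_mem hf hg

/-! ### Delsarte potentials -/

variable {n : ℕ}

/-- The potential with matrix of exponents `A`, all of whose coefficients are one. -/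
def potential (A : Matrix (Fin n) (Fin n) ℕ) : MvPolynomial (Fin n) ℂ :=
  ∑ i, ∏ j, X j ^ A i j

/-- The charges `q = A⁻¹ 1`. -/
def charges (A : Matrix (Fin n) (Fin n) ℕ) : Fin n → ℚ :=
  (A.map (fun a => (a : ℚ)))⁻¹.mulVec 1

/-- The degree `d`: the least positive integer such that `d q` is integral. -/
def degree (A : Matrix (Fin n) (Fin n) ℕ) : ℕ :=
  Finset.univ.lcm fun i => (charges A i).den

/-- The weights `w = d q` (they are positive when the charges are). -/
def weights (A : Matrix (Fin n) (Fin n) ℕ) (i : Fin n) : ℕ :=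
  ((degree A : ℚ) * charges A i).num.toNat

/-- The standing assumptions on an invertible, non-degenerate potential of Calabi-Yau type. -/
structure IsCalabiYau (A : Matrix (Fin n) (Fin n) ℕ) : Prop where
  /-- `A` is invertible over `ℚ` -/
  invertible : (A.map (fun a => (a : ℚ))).det ≠ 0
  /-- the weights are positive -/
  charges_pos : ∀ i, 0 < charges A i
  /-- the weights are normalized -/
  normalized : ∀ i, (Finset.univ.erase i).gcd (weights A) = 1
  /-- the affine cone `W = 0` is smooth outside the origin -/
  nondegenerate : ∀ x : Fin n → ℂ, x ≠ 0 → eval x (potential A) = 0 →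
    ∃ i, eval x (pderiv i (potential A)) ≠ 0
  /-- the Calabi-Yau condition -/
  calabiYau : ∑ i, weights A i = degree A

/-! ### The hypersurface `X_W` in weighted projective space -/

/-- Two vectors are equivalent for the weights `w` if they lie in one orbit of the action
`t • x = (t ^ w_1 x_1, …, t ^ w_n x_n)` of `ℂˣ`. -/
def WeightedEquiv (w : Fin n → ℕ) (x y : Fin n → ℂ) : Prop :=
  ∃ t : ℂˣ, ∀ i, y i = (t : ℂ) ^ w i * x i

theorem WeightedEquiv.refl (w : Fin n → ℕ) (x : Fin n → ℂ) : WeightedEquiv w x x :=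
  ⟨1, fun i => by simp⟩

theorem WeightedEquiv.symm {w : Fin n → ℕ} {x y : Fin n → ℂ} (h : WeightedEquiv w x y) :
    WeightedEquiv w y x := by
  obtain ⟨t, ht⟩ := h
  refine ⟨t⁻¹, fun i => ?_⟩
  rw [ht i, ← mul_assoc, ← mul_pow]
  simp

theorem WeightedEquiv.trans {w : Fin n → ℕ} {x y z : Fin n → ℂ} (h : WeightedEquiv w x y)
    (h' : WeightedEquiv w y z) : WeightedEquiv w x z := by
  obtain ⟨t, ht⟩ := h
  obtain ⟨s, hs⟩ := h'
  refine ⟨s * t, fun i => ?_⟩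
  rw [hs i, ht i, ← mul_assoc, Units.val_mul, mul_pow]

/-- The affine cone `W = 0` without the origin. -/
abbrev Cone (A : Matrix (Fin n) (Fin n) ℕ) : Type :=
  {x : Fin n → ℂ // x ≠ 0 ∧ eval x (potential A) = 0}

instance coneSetoid (A : Matrix (Fin n) (Fin n) ℕ) : Setoid (Cone A) where
  r x y := WeightedEquiv (weights A) x.1 y.1
  iseqv := ⟨fun _ => .refl _ _, .symm, .trans⟩

/-- The set of points of `X_W`, the zero set of `W` in the weighted projective space `ℙ(w)`. -/
def Points (A : Matrix (Fin n) (Fin n) ℕ) : Type := Quotient (coneSetoid A)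

/-- The point of `X_W` with given weighted homogeneous coordinates. -/
def Points.mk {A : Matrix (Fin n) (Fin n) ℕ} (x : Cone A) : Points A := Quotient.mk _ x

/-- The Zariski topology, generated by the non-vanishing loci of the
weighted homogeneous polynomials. -/
instance zariski (A : Matrix (Fin n) (Fin n) ℕ) : TopologicalSpace (Points A) :=
  TopologicalSpace.generateFrom
    {U | ∃ (F : MvPolynomial (Fin n) ℂ) (m : ℕ), F.IsWeightedHomogeneous (weights A) m ∧
      U = {p | ∀ x : Cone A, Points.mk x = p → eval x.1 F ≠ 0}}

/-- Quotients `F / G` of weighted homogeneous polynomials of the same degree, with `G` vanishing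
nowhere on `U`. -/
def fractions (A : Matrix (Fin n) (Fin n) ℕ) :
    TopCat.PrelocalPredicate (fun _ : TopCat.of (Points A) => ℂ) where
  pred := fun {U} f => ∃ (m : ℕ) (F G : MvPolynomial (Fin n) ℂ),
    F.IsWeightedHomogeneous (weights A) m ∧ G.IsWeightedHomogeneous (weights A) m ∧
    ∀ (x : Cone A) (hx : Points.mk x ∈ U),
      eval x.1 G ≠ 0 ∧ f ⟨Points.mk x, hx⟩ = eval x.1 F / eval x.1 G
  res := by
    rintro U V i f ⟨m, F, G, hF, hG, h⟩
    exact ⟨m, F, G, hF, hG, fun x hx => h x (CategoryTheory.leOfHom i hx)⟩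

theorem fractions_const (A : Matrix (Fin n) (Fin n) ℕ) (U : Opens (TopCat.of (Points A)))
    (c : ℂ) : (fractions A).pred (U := U) (fun _ => c) :=
  ⟨0, C c, C 1, isWeightedHomogeneous_C _ _, isWeightedHomogeneous_C _ _, fun x _ => by simp⟩

/-- The variety `X_W ⊂ ℙ(w)`: a function is regular iff it is, near each point, a quotient of
weighted homogeneous polynomials of the same degree. -/
def hypersurface (A : Matrix (Fin n) (Fin n) ℕ) : FunctionSpace where
  space := TopCat.of (Points A)
  regular := (fractions A).sheafify
  const_mem := fun U c => TopCat.PrelocalPredicate.sheafifyOf (fractions_const A U c)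
  add_mem := fun hf hg => (fractions A).sheafify_inductionOn₂' _ (fractions A) (· + ·)
    (by
      rintro U V a b ⟨m, F, G, hF, hG, h⟩ ⟨m', F', G', hF', hG', h'⟩
      refine ⟨m + m', F * G' + G * F', G * G', (hF.mul hG').add (hG.mul hF'), hG.mul hG',
        fun x hx => ?_⟩
      obtain ⟨h1, h2⟩ := h x hx.1
      obtain ⟨h3, h4⟩ := h' x hx.2
      refine ⟨by simp [h1, h3], ?_⟩
      simp only [h2, h4, map_add, map_mul]
      exact div_add_div _ _ h1 h3) hf hg
  mul_mem := fun hf hg => (fractions A).sheafify_inductionOn₂' _ (fractions A) (· * ·)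
    (by
      rintro U V a b ⟨m, F, G, hF, hG, h⟩ ⟨m', F', G', hF', hG', h'⟩
      refine ⟨m + m', F * F', G * G', hF.mul hF', hG.mul hG', fun x hx => ?_⟩
      obtain ⟨h1, h2⟩ := h x hx.1
      obtain ⟨h3, h4⟩ := h' x hx.2
      refine ⟨by simp [h1, h3], ?_⟩
      simp only [h2, h4, map_mul]
      exact div_mul_div_comm _ _ _ _) hf hg

/-! ### The groups `SL(W)`, `J_W` and `SL(W) / J_W` -/

/-- The diagonal linear map with entries `g`, applied to `x`. -/
def diagMul (g : Fin n → ℂˣ) (x : Fin n → ℂ) : Fin n → ℂ := fun i => g i * x i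

theorem diagMul_one (x : Fin n → ℂ) : diagMul 1 x = x := by
  funext i; simp [diagMul]

theorem diagMul_mul (g h : Fin n → ℂˣ) (x : Fin n → ℂ) :
    diagMul (g * h) x = diagMul g (diagMul h x) := by
  funext i; simp [diagMul, mul_assoc]

theorem diagMul_ne_zero (g : Fin n → ℂˣ) {x : Fin n → ℂ} (hx : x ≠ 0) : diagMul g x ≠ 0 := by
  obtain ⟨i, hi⟩ := Function.ne_iff.mp hx
  exact Function.ne_iff.mpr ⟨i, mul_ne_zero (g i).ne_zero hi⟩

theorem WeightedEquiv.diagMul {w : Fin n → ℕ} {x y : Fin n → ℂ} (g : Fin n → ℂˣ)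
    (h : WeightedEquiv w x y) : WeightedEquiv w (diagMul g x) (diagMul g y) := by
  obtain ⟨t, ht⟩ := h
  exact ⟨t, fun i => by simp only [Delsarte.diagMul, ht i]; ring⟩

/-- `Aut(W)`: the diagonal linear automorphisms leaving `W` invariant. -/
def autGroup (A : Matrix (Fin n) (Fin n) ℕ) : Subgroup (Fin n → ℂˣ) where
  carrier := {g | ∀ x, eval (diagMul g x) (potential A) = eval x (potential A)}
  one_mem' := fun x => by rw [diagMul_one]
  mul_mem' := fun {g h} hg hh x => by rw [diagMul_mul, hg, hh]
  inv_mem' := fun {g} hg x => by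
    rw [← hg (diagMul g⁻¹ x), ← diagMul_mul, mul_inv_cancel, diagMul_one]

/-- `SL(W)`: the elements of `Aut(W)` of determinant one. -/
def SL (A : Matrix (Fin n) (Fin n) ℕ) : Subgroup (Fin n → ℂˣ) where
  carrier := {g | g ∈ autGroup A ∧ ∏ i, g i = 1}
  one_mem' := ⟨one_mem _, by simp⟩
  mul_mem' := fun {g h} hg hh => ⟨mul_mem hg.1 hh.1, by
    simp [Finset.prod_mul_distrib, hg.2, hh.2]⟩
  inv_mem' := fun {g} hg => ⟨inv_mem hg.1, by simp [hg.2]⟩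

/-- `J_W`: the elements of `SL(W)` acting trivially on the weighted projective space `ℙ(w)`. -/
def J (A : Matrix (Fin n) (Fin n) ℕ) : Subgroup (SL A) where
  carrier := {g | ∀ x : Fin n → ℂ, x ≠ 0 → WeightedEquiv (weights A) x (diagMul g.1 x)}
  one_mem' := fun x _ => by
    rw [Subgroup.coe_one, diagMul_one]
    exact .refl _ _
  mul_mem' := fun {g h} hg hh x hx => by
    rw [Subgroup.coe_mul, diagMul_mul]
    exact (hh x hx).trans (hg _ (diagMul_ne_zero _ hx))
  inv_mem' := fun {g} hg x hx => by
    have h := hg _ (diagMul_ne_zero (g⁻¹ : SL A).1 hx)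
    rw [← diagMul_mul, ← Subgroup.coe_mul, mul_inv_cancel, Subgroup.coe_one, diagMul_one] at h
    exact h.symm

/-- The group `SL(W) / J_W`. -/
abbrev SLt (A : Matrix (Fin n) (Fin n) ℕ) : Type := SL A ⧸ J A

/-- The action of `SL(W)` on the cone. -/
def coneMap {A : Matrix (Fin n) (Fin n) ℕ} (g : SL A) (x : Cone A) : Cone A :=
  ⟨diagMul g.1 x.1, diagMul_ne_zero _ x.2.1, (g.2.1 x.1).trans x.2.2⟩

instance slAction (A : Matrix (Fin n) (Fin n) ℕ) : MulAction (SL A) (Points A) where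
  smul g := Quotient.map (coneMap g) fun _ _ h => h.diagMul g.1
  one_smul p := by
    induction p using Quotient.inductionOn with
    | h x => exact congrArg Points.mk (Subtype.ext (diagMul_one x.1))
  mul_smul g h p := by
    induction p using Quotient.inductionOn with
    | h x => exact congrArg Points.mk (Subtype.ext (diagMul_mul g.1 h.1 x.1))

theorem smul_mk {A : Matrix (Fin n) (Fin n) ℕ} (g : SL A) (x : Cone A) :
    g • Points.mk x = Points.mk (coneMap g x) := rfl

theorem J_le_ker (A : Matrix (Fin n) (Fin n) ℕ) :
    J A ≤ (MulAction.toPermHom (SL A) (Points A)).ker := by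
  intro g hg
  rw [MonoidHom.mem_ker]
  ext p
  induction p using Quotient.inductionOn with
  | h x => exact Quotient.sound (hg x.1 x.2.1).symm

/-- The action of `SL(W) / J_W` on `X_W` induced by that of `SL(W)`. -/
instance sltAction (A : Matrix (Fin n) (Fin n) ℕ) : MulAction (SLt A) (hypersurface A).space :=
  MulAction.compHom (Points A)
    (QuotientGroup.lift (J A) (MulAction.toPermHom (SL A) (Points A)) (J_le_ker A))

theorem mk_smul_mk {A : Matrix (Fin n) (Fin n) ℕ} (g : SL A) (x : Cone A) :
    HSMul.hSMul (α := SLt A) (β := (hypersurface A).space) (γ := (hypersurface A).space)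
      (QuotientGroup.mk g) (Points.mk x) = Points.mk (coneMap g x) := rfl

/-! ### The table of potentials in three variables -/

/-- The potentials of `A` and `B` agree up to renaming the variables
(and listing the monomials in another order). -/
def SameUpToRenaming (A B : Matrix (Fin n) (Fin n) ℕ) : Prop :=
  ∃ σ τ : Equiv.Perm (Fin n), A.submatrix σ τ = B

/-- The thirteen potentials; entry `k` of the list has number `k + 1` in the table. -/
def table : Fin 13 → Matrix (Fin 3) (Fin 3) ℕ :=
  ![!![3, 0, 0; 0, 3, 0; 0, 0, 3],
    !![2, 1, 0; 0, 2, 1; 0, 0, 3],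
    !![2, 1, 0; 0, 2, 1; 1, 0, 2],
    !![3, 0, 0; 0, 2, 1; 0, 0, 3],
    !![3, 0, 0; 0, 2, 1; 0, 1, 2],
    !![2, 0, 0; 0, 4, 0; 0, 0, 4],
    !![2, 0, 0; 1, 2, 0; 0, 1, 3],
    !![2, 0, 0; 0, 3, 1; 0, 0, 4],
    !![2, 0, 0; 1, 2, 0; 0, 0, 4],
    !![2, 0, 0; 0, 3, 1; 0, 1, 3],
    !![2, 0, 0; 0, 3, 0; 0, 0, 6],
    !![2, 0, 0; 0, 3, 0; 0, 1, 4],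
    !![2, 0, 0; 1, 0, 3; 0, 3, 0]]

/-- The weights `(w_0, w_1, w_2)` of the thirteen potentials. -/
def tableWeights : Fin 13 → Fin 3 → ℕ :=
  ![![1, 1, 1], ![1, 1, 1], ![1, 1, 1], ![1, 1, 1], ![1, 1, 1],
    ![2, 1, 1], ![2, 1, 1], ![2, 1, 1], ![2, 1, 1], ![2, 1, 1],
    ![3, 2, 1], ![3, 2, 1], ![3, 2, 1]]

/-- The orders of `J_W`. -/
def tableJ : Fin 13 → ℕ := ![3, 3, 3, 3, 3, 4, 4, 4, 4, 4, 6, 6, 6]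

/-- The orders of `SL(W)`. -/
def tableSL : Fin 13 → ℕ := ![9, 3, 3, 3, 3, 8, 4, 4, 4, 4, 6, 6, 6]

/-- The orders of `SL(W) / J_W`. -/
def tableSLt : Fin 13 → ℕ := ![3, 1, 1, 1, 1, 2, 1, 1, 1, 1, 1, 1, 1]

/-- The position in the list of the mirror, defined by the transposed matrix of exponents. -/
def mirror : Fin 13 → Fin 13 := ![0, 6, 2, 12, 4, 5, 1, 11, 8, 9, 10, 7, 3]

end Delsarte

end

namespace Delsarte

variable {n : ℕ}

/-! ### Weighted homogeneous polynomials -/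

/-! Classification. If `W` is smooth outside the origin, testing it at the coordinate points gives
for each `x_j` a monomial `x_j ^ a` or `x_j ^ a * x_l`, and testing it on coordinate planes shows
that two variables never point to the same third one. The Calabi-Yau condition gives `a ≥ 2`, so
monomials correspond bijectively to variables. It also makes each weight divide the sum of the other
two, and for pairwise coprime weights this leaves `(1,1,1)`, `(2,1,1)` and `(3,2,1)`. For each of
these only finitely many exponent matrices remain, and they are compared with the table by
computation (`IsCalabiYau.exists_table`).

Groups. Distinct monomials are linearly independent, so `SL(W)` consists of the diagonal maps of
determinant one fixing every monomial. The scalings `t ^ w_i` in it form the group of `d`-th roots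
of unity, which is `J_W`. Outside Nos. 1 and 6 the equations give `g_i = g_2 ^ w_i`, hence `SL(W) =
J_W`.

Quotients. Nos. 1 and 6 are the cases `(p, k) = (3, 1)` and `(2, 2)` of `x₀ᵖ + x₁ᵖᵏ + x₂ᵖᵏ` with `pk
= k + 2`, and the group acts through the maps `(μ⁻¹, μ, 1)`, `μᵖ = 1`. The functions `x₀x₁x₂, x₁ᵖ,
x₂ᵖ` map the curve onto `y₀ᵖ + y₁ᵏ⁺¹y₂ + y₁y₂ᵏ⁺¹ = 0`, which is No. 5 or No. 10, and the fibres are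
the orbits (`exists_coneCharMul_eq`). That topology and regular functions are also those of the
quotient follows by splitting polynomials into isotypic parts: each part becomes invariant after
multiplication by a monomial that is nonzero at the given point, and modulo `W` it is then a
polynomial in the three functions (`exists_mul_isotypic`).

For potentials `x₀² + f` only No. 6 has a nontrivial group. Its quotient No. 10 is isomorphic to No.
6 by a linear change of `x₁, x₂`, and to No. 2 by the birational map `(x₀x₁, x₁, x₂)`, which extends
to an isomorphism. -/

theorem addChar_sum {ι M : Type*} [AddCommMonoid M] (χ : AddChar M ℂ) (s : Finset ι) (f : ι → M) :
    χ (∑ i ∈ s, f i) = ∏ i ∈ s, χ (f i) := by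
  classical
  induction s using Finset.induction_on with
  | empty => simp
  | insert i s hi h => rw [Finset.sum_insert hi, Finset.prod_insert hi, AddChar.map_add_eq_mul, h]

/-- One formula serves two gradings: with `k ↦ t ^ k` on `ℕ` it is weighted homogeneity, with a
character of `ZMod p` it is the action of the cyclic group on an isotypic part. -/
theorem eval_addChar_mul {M : Type*} [AddCommMonoid M] {w : Fin n → M} {m : M}
    {F : MvPolynomial (Fin n) ℂ} (hF : F.IsWeightedHomogeneous w m) (χ : AddChar M ℂ)
    (x : Fin n → ℂ) : eval (fun i => χ (w i) * x i) F = χ m * eval x F := by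
  induction hF using IsWeightedHomogeneous.induction_on with
  | zero => simp
  | add p q hp hq h1 h2 => rw [map_add, map_add, h1, h2, mul_add]
  | monomial a r hr =>
    rw [eval_monomial, eval_monomial, ← hr, Finsupp.weight_apply, Finsupp.sum,
      addChar_sum, Finsupp.prod, Finsupp.prod]
    simp only [mul_pow, Finset.prod_mul_distrib, AddChar.map_nsmul_eq_pow]
    ring

theorem eval_pow_mul {w : Fin n → ℕ} {m : ℕ} {F : MvPolynomial (Fin n) ℂ}
    (hF : F.IsWeightedHomogeneous w m) (t : ℂ) (x : Fin n → ℂ) :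
    eval (fun i => t ^ w i * x i) F = t ^ m * eval x F :=
  eval_addChar_mul hF ⟨fun k => t ^ k, pow_zero t, pow_add t⟩ x

theorem isWeightedHomogeneous_bind₁ {w w' : Fin n → ℕ} {e m : ℕ}
    {P : Fin n → MvPolynomial (Fin n) ℂ} (hP : ∀ j, (P j).IsWeightedHomogeneous w (e * w' j))
    {F : MvPolynomial (Fin n) ℂ} (hF : F.IsWeightedHomogeneous w' m) :
    (bind₁ P F).IsWeightedHomogeneous w (e * m) := by
  induction hF using IsWeightedHomogeneous.induction_on with
  | zero => simpa using isWeightedHomogeneous_zero ℂ w _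
  | add p q hp hq h1 h2 => simpa using h1.add h2
  | monomial a r hr =>
    rw [bind₁_monomial]
    refine IsWeightedHomogeneous.C_mul ?_ r
    rw [← hr, Finsupp.weight_apply, Finsupp.sum, Finset.mul_sum]
    refine IsWeightedHomogeneous.prod _ _ _ fun i _ => ?_
    have := (hP i).pow (a i)
    rwa [smul_eq_mul, mul_left_comm, ← smul_eq_mul] at this

theorem eval_bind₁ (P : Fin n → MvPolynomial (Fin n) ℂ) (F : MvPolynomial (Fin n) ℂ)
    (x : Fin n → ℂ) : eval x (bind₁ P F) = eval (fun j => eval x (P j)) F := by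
  induction F using MvPolynomial.induction_on with
  | C a => simp
  | add p q hp hq => simp [hp, hq]
  | mul_X p i hp => simp [hp]

/-! ### Open sets and regular functions -/

variable {A B : Matrix (Fin n) (Fin n) ℕ}

theorem Points.mk_eq_mk {x y : Cone A} :
    Points.mk x = Points.mk y ↔ WeightedEquiv (weights A) x.1 y.1 :=
  Quotient.eq

theorem Points.exists_rep (p : Points A) : ∃ x, Points.mk x = p :=
  Quotient.exists_rep p

theorem eval_ne_zero_of_mk_eq {F : MvPolynomial (Fin n) ℂ} {m : ℕ}
    (hF : F.IsWeightedHomogeneous (weights A) m) {x y : Cone A} (h : Points.mk x = Points.mk y)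
    (hx : eval x.1 F ≠ 0) : eval y.1 F ≠ 0 := by
  obtain ⟨t, ht⟩ := Points.mk_eq_mk.1 h
  rw [funext ht, eval_pow_mul hF]
  exact mul_ne_zero (pow_ne_zero _ t.ne_zero) hx

/-- The generating sets are already a basis, because a product of polynomials cuts out the
intersection of the non-vanishing loci. This form lets openness be tested on the cone. -/
theorem isOpen_points_iff {U : Set (Points A)} :
    IsOpen U ↔ ∀ x : Cone A, Points.mk x ∈ U → ∃ (m : ℕ) (F : MvPolynomial (Fin n) ℂ),
      F.IsWeightedHomogeneous (weights A) m ∧ eval x.1 F ≠ 0 ∧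
      ∀ y : Cone A, eval y.1 F ≠ 0 → Points.mk y ∈ U := by
  constructor
  · intro hU
    induction hU with
    | basic U hU =>
      obtain ⟨F, m, hF, rfl⟩ := hU
      exact fun x hx => ⟨m, F, hF, hx x rfl, fun y hy z hz =>
        eval_ne_zero_of_mk_eq hF hz.symm hy⟩
    | univ =>
      exact fun x _ => ⟨0, 1, isWeightedHomogeneous_one _ _, by simp, fun y _ => trivial⟩
    | inter U V _ _ h1 h2 =>
      rintro x ⟨hx, hx'⟩
      obtain ⟨m, F, hF, hFx, h⟩ := h1 x hx
      obtain ⟨m', F', hF', hFx', h'⟩ := h2 x hx'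
      refine ⟨m + m', F * F', hF.mul hF', by simp [hFx, hFx'], fun y hy => ?_⟩
      rw [map_mul, mul_ne_zero_iff] at hy
      exact ⟨h y hy.1, h' y hy.2⟩
    | sUnion S _ h =>
      rintro x ⟨U, hU, hx⟩
      obtain ⟨m, F, hF, hFx, h'⟩ := h U hU x hx
      exact ⟨m, F, hF, hFx, fun y hy => ⟨U, hU, h' y hy⟩⟩
  · intro h
    refine isOpen_iff_forall_mem_open.2 fun p hp => ?_
    obtain ⟨x, rfl⟩ := p.exists_rep
    obtain ⟨m, F, hF, hFx, h'⟩ := h x hp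
    refine ⟨{p | ∀ x : Cone A, Points.mk x = p → eval x.1 F ≠ 0}, fun q hq => ?_,
      GenerateOpen.basic _ ⟨F, m, hF, rfl⟩, fun z hz => eval_ne_zero_of_mk_eq hF hz.symm hFx⟩
    obtain ⟨y, rfl⟩ := q.exists_rep
    exact h' y (hq y rfl)

/-- A local fraction valid on a smaller open set becomes a relation `f * G = F` on all of `U` once
both sides are multiplied by a polynomial vanishing outside that set. No neighbourhood has to be
carried along afterwards. -/
theorem regular_hypersurface_iff {U : Opens (hypersurface A).space} {f : U → ℂ} :
    (hypersurface A).regular.pred f ↔ ∀ (x : Cone A), Points.mk x ∈ U →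
      ∃ (m : ℕ) (F G : MvPolynomial (Fin n) ℂ), F.IsWeightedHomogeneous (weights A) m ∧
        G.IsWeightedHomogeneous (weights A) m ∧ eval x.1 G ≠ 0 ∧
        ∀ (y : Cone A) (hy : Points.mk y ∈ U), f ⟨Points.mk y, hy⟩ * eval y.1 G = eval y.1 F := by
  constructor
  · intro hf x hx
    obtain ⟨V, hxV, i, m, F, G, hF, hG, h⟩ := hf ⟨Points.mk x, hx⟩
    obtain ⟨m', H, hH, hHx, hHV⟩ := isOpen_points_iff.1 V.isOpen x hxV
    refine ⟨m' + m, H * F, H * G, hH.mul hF, hH.mul hG, ?_, fun y hy => ?_⟩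
    · rw [map_mul]
      exact mul_ne_zero hHx (h x hxV).1
    · rw [map_mul, map_mul]
      by_cases hy' : eval y.1 H = 0
      · simp [hy']
      · obtain ⟨h1, h2⟩ := h y (hHV y hy')
        have h3 : f ⟨Points.mk y, hy⟩ = eval y.1 F / eval y.1 G := h2
        rw [h3]
        field_simp
  · rintro h ⟨p, hp⟩
    obtain ⟨x, rfl⟩ := Points.exists_rep p
    obtain ⟨m, F, G, hF, hG, hGx, h⟩ := h x hp
    let V : Opens (hypersurface A).space :=
      ⟨{p | ∀ x : Cone A, Points.mk x = p → eval x.1 G ≠ 0}, GenerateOpen.basic _ ⟨G, m, hG, rfl⟩⟩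
    refine ⟨U ⊓ V, ⟨hp, fun z hz => eval_ne_zero_of_mk_eq hG hz.symm hGx⟩,
      CategoryTheory.homOfLE inf_le_left, m, F, G, hF, hG, fun y hy => ⟨hy.2 y rfl, ?_⟩⟩
    exact eq_div_of_mul_eq (hy.2 y rfl) (h y hy.1)

/-! ### Morphisms given locally by weighted homogeneous polynomials -/

/-- A map is a morphism if it is given by weighted homogeneous polynomials
near every point. -/
def IsMorphism (φ : Points A → Points B) : Prop :=
  ∀ x : Cone A, ∃ (e : ℕ) (P : Fin n → MvPolynomial (Fin n) ℂ),
    (∀ j, (P j).IsWeightedHomogeneous (weights A) (e * weights B j)) ∧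
    (fun j => eval x.1 (P j)) ≠ 0 ∧
    ∀ y : Cone A, (fun j => eval y.1 (P j)) ≠ 0 →
      ∃ z : Cone B, z.1 = (fun j => eval y.1 (P j)) ∧ φ (Points.mk y) = Points.mk z

theorem IsMorphism.continuous {φ : Points A → Points B} (hφ : IsMorphism φ) :
    Continuous φ := by
  refine continuous_def.2 fun U hU => isOpen_points_iff.2 fun x hx => ?_
  obtain ⟨e, P, hP, hPx, h⟩ := hφ x
  obtain ⟨z, hz, hxz⟩ := h x hPx
  obtain ⟨j, hj⟩ := Function.ne_iff.1 hPx
  rw [Set.mem_preimage, hxz] at hx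
  obtain ⟨m, F, hF, hFz, hFU⟩ := isOpen_points_iff.1 hU z hx
  -- The factor `P j` restricts to points where the tuple `P` is nonzero, hence describes `φ`.
  refine ⟨_, P j * bind₁ P F, (hP j).mul (isWeightedHomogeneous_bind₁ hP hF), ?_, fun y hy => ?_⟩
  · rw [map_mul, eval_bind₁, ← hz]
    exact mul_ne_zero hj hFz
  · rw [map_mul, eval_bind₁, mul_ne_zero_iff] at hy
    obtain ⟨z', hz', hyz'⟩ := h y (Function.ne_iff.2 ⟨j, hy.1⟩)
    rw [Set.mem_preimage, hyz']
    exact hFU z' (hz' ▸ hy.2)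

theorem IsMorphism.exists_fraction {φ : Points A → Points B} (hφ : IsMorphism φ)
    {U : Opens (hypersurface B).space} {f : U → ℂ} (hf : (hypersurface B).regular.pred f)
    (x : Cone A) (hx : φ (Points.mk x) ∈ U) :
    ∃ (m : ℕ) (F G : MvPolynomial (Fin n) ℂ), F.IsWeightedHomogeneous (weights A) m ∧
      G.IsWeightedHomogeneous (weights A) m ∧ eval x.1 G ≠ 0 ∧
      ∀ (y : Cone A) (hy : φ (Points.mk y) ∈ U),
        f ⟨φ (Points.mk y), hy⟩ * eval y.1 G = eval y.1 F := by
  obtain ⟨e, P, hP, hPx, h⟩ := hφ x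
  obtain ⟨z, hz, hxz⟩ := h x hPx
  obtain ⟨j, hj⟩ := Function.ne_iff.1 hPx
  obtain ⟨m, F, G, hF, hG, hGz, hFG⟩ := regular_hypersurface_iff.1 hf z (hxz ▸ hx)
  refine ⟨_, P j * bind₁ P F, P j * bind₁ P G, (hP j).mul (isWeightedHomogeneous_bind₁ hP hF),
    (hP j).mul (isWeightedHomogeneous_bind₁ hP hG), ?_, fun y hy => ?_⟩
  · rw [map_mul, eval_bind₁, ← hz]
    exact mul_ne_zero hj hGz
  · rw [map_mul, map_mul, eval_bind₁, eval_bind₁]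
    by_cases hy' : eval y.1 (P j) = 0
    · simp [hy']
    · obtain ⟨z', hz', hyz'⟩ := h y (Function.ne_iff.2 ⟨j, hy'⟩)
      have h1 := hFG z' (hyz' ▸ hy)
      rw [← hz', ← h1, mul_left_comm]
      congr 3
      exact Subtype.ext hyz'

theorem IsMorphism.regular_comp {φ : Points A → Points B} (hφ : IsMorphism φ)
    (U : Opens (hypersurface B).space) {f : U → ℂ} (hf : (hypersurface B).regular.pred f) :
    (hypersurface A).regular.pred
      (U := Opens.comap (⟨φ, hφ.continuous⟩ : C((hypersurface A).space, (hypersurface B).space)) U)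
      (fun x => f ⟨φ x.1, x.2⟩) :=
  regular_hypersurface_iff.2 fun x hx => hφ.exists_fraction hf x hx

/-- Mutually inverse morphisms form an isomorphism. -/
def isoOfMorphisms (φ : Points A → Points B) (ψ : Points B → Points A) (hφ : IsMorphism φ)
    (hψ : IsMorphism ψ) (h : ∀ p, ψ (φ p) = p) (h' : ∀ q, φ (ψ q) = q) :
    FunctionSpace.Iso (hypersurface A) (hypersurface B) where
  toHomeomorph :=
    { toFun := φ
      invFun := ψ
      left_inv := h
      right_inv := h'
      continuous_toFun := hφ.continuous
      continuous_invFun := hψ.continuous }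
  regular_iff U f := by
    refine ⟨hφ.regular_comp U, fun hf => regular_hypersurface_iff.2 fun z hz => ?_⟩
    obtain ⟨m, F, G, hF, hG, hGz, hFG⟩ := hψ.exists_fraction hf z
      (show φ (ψ (Points.mk z)) ∈ U from (h' _).symm ▸ hz)
    refine ⟨m, F, G, hF, hG, hGz, fun y hy => ?_⟩
    rw [← hFG y (show φ (ψ (Points.mk y)) ∈ U from (h' _).symm ▸ hy)]
    congr 2
    exact Subtype.ext (h' _).symm

/-- The composition of isomorphisms. -/
def FunctionSpace.Iso.trans {X Y Z : FunctionSpace} (a : FunctionSpace.Iso X Y)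
    (b : FunctionSpace.Iso Y Z) : FunctionSpace.Iso X Z where
  toHomeomorph := a.toHomeomorph.trans b.toHomeomorph
  regular_iff U f := (b.regular_iff U f).trans (a.regular_iff _ _)

/-- A surjective map identifying the topology and the regular functions with those of the target
induces an isomorphism from the quotient by a group whose orbits are the fibres. -/
noncomputable def quotientIso {X Y : FunctionSpace} (G : Type) [Group G] [MulAction G X.space]
    (π : X.space → Y.space) (hπ : Function.Surjective π)
    (horb : ∀ x y, (∃ g : G, g • x = y) ↔ π x = π y) (hc : Continuous π)
    (ho : ∀ U : Set Y.space, IsOpen (π ⁻¹' U) → IsOpen U)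
    (hreg : ∀ (U : Opens Y.space) (f : U → ℂ),
      Y.regular.pred f ↔ X.regular.pred (U := Opens.comap ⟨π, hc⟩ U) (fun x => f ⟨π x.1, x.2⟩)) :
    FunctionSpace.Iso (X.quotient G) Y := by
  have hl : ∀ x y, (MulAction.orbitRel G X.space) x y → π x = π y := fun x y h =>
    ((horb y x).1 h).symm
  refine
    { toHomeomorph := (Equiv.ofBijective (Quotient.lift π hl : (X.quotient G).space → Y.space)
          ⟨?_, ?_⟩).toHomeomorph fun s => ⟨fun h => ho s (isOpen_coinduced.1 h), fun h =>
            isOpen_coinduced.2 (h.preimage hc)⟩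
      regular_iff := fun U f => hreg U f }
  · rintro ⟨x⟩ ⟨y⟩ h
    exact Quotient.sound ((horb y x).2 (Eq.symm h))
  · intro y
    obtain ⟨x, rfl⟩ := hπ y
    exact ⟨Quotient.mk _ x, rfl⟩

/-! ### Isotypic components for the cyclic group of diagonal maps `(μ⁻¹, μ, 1)` -/

section CyclicQuotient

variable {p k : ℕ}

/-- The characters of the coordinates under the maps `(μ⁻¹, μ, 1)`. -/
def charWeight (p : ℕ) : Fin 3 → ZMod p := ![-1, 1, 0]

/-- The part of a polynomial on which the group of the maps `(μ⁻¹, μ, 1)` acts by the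
character `l`. -/
noncomputable def isotypic (l : ZMod p) (F : MvPolynomial (Fin 3) ℂ) : MvPolynomial (Fin 3) ℂ :=
  weightedHomogeneousComponent (charWeight p) l F

/-- The diagonal map `(χ(-1), χ(1), 1)`. -/
noncomputable def charMul (χ : AddChar (ZMod p) ℂ) (x : Fin 3 → ℂ) : Fin 3 → ℂ :=
  fun i => χ (charWeight p i) * x i

theorem isWeightedHomogeneous_isotypic {w : Fin 3 → ℕ} {m : ℕ} {F : MvPolynomial (Fin 3) ℂ}
    (hF : F.IsWeightedHomogeneous w m) (l : ZMod p) :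
    (isotypic l F).IsWeightedHomogeneous w m := by
  classical
  intro a ha
  rw [isotypic, coeff_weightedHomogeneousComponent] at ha
  split_ifs at ha with h
  · exact hF ha
  · exact absurd rfl ha

theorem eval_charMul [NeZero p] (χ : AddChar (ZMod p) ℂ) (F : MvPolynomial (Fin 3) ℂ)
    (x : Fin 3 → ℂ) : eval (charMul χ x) F = ∑ l, χ l * eval x (isotypic l F) := by
  conv_lhs => rw [← sum_weightedHomogeneousComponent (charWeight p) F, finsum_eq_sum_of_fintype,
    map_sum]
  exact Finset.sum_congr rfl fun l _ =>
    eval_addChar_mul (weightedHomogeneousComponent_isWeightedHomogeneous l F) χ x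

/-- Orthogonality of the characters of `ZMod p`: the isotypic part at a point is a weighted average
of the polynomial over the orbit. Hence relations valid on an orbit pass to isotypic parts, and a
nonzero isotypic part forces a nonzero value somewhere on the orbit. -/
theorem sum_eval_charMul [NeZero p] (l : ZMod p) (F : MvPolynomial (Fin 3) ℂ) (x : Fin 3 → ℂ) :
    ∑ χ : AddChar (ZMod p) ℂ, χ (-l) * eval (charMul χ x) F = p * eval x (isotypic l F) := by
  simp only [eval_charMul, Finset.mul_sum]
  rw [Finset.sum_comm]
  have h : ∀ j : ZMod p, ∑ χ : AddChar (ZMod p) ℂ, χ (-l) * (χ j * eval x (isotypic j F)) =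
      if j = l then p * eval x (isotypic j F) else 0 := fun j => by
    simp only [← mul_assoc, ← AddChar.map_add_eq_mul, ← Finset.sum_mul]
    rw [AddChar.sum_apply_eq_ite, ZMod.card]
    simp only [neg_add_eq_zero, eq_comm (a := l)]
    split_ifs <;> simp
  simp [h]

theorem exists_isotypic_ne_zero [NeZero p] {F : MvPolynomial (Fin 3) ℂ} {x : Fin 3 → ℂ}
    (h : eval x F ≠ 0) : ∃ l : ZMod p, eval x (isotypic l F) ≠ 0 := by
  by_contra! h'
  have := eval_charMul (1 : AddChar (ZMod p) ℂ) F x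
  rw [Finset.sum_eq_zero fun l _ => by rw [h' l, mul_zero]] at this
  have h1 : charMul (1 : AddChar (ZMod p) ℂ) x = x := funext fun i => by simp [charMul]
  exact h (h1 ▸ this)

theorem exists_charMul_ne_zero [NeZero p] {F : MvPolynomial (Fin 3) ℂ} {x : Fin 3 → ℂ}
    {l : ZMod p} (h : eval x (isotypic l F) ≠ 0) :
    ∃ χ : AddChar (ZMod p) ℂ, eval (charMul χ x) F ≠ 0 := by
  by_contra! h'
  have := sum_eval_charMul l F x
  rw [Finset.sum_eq_zero fun χ _ => by rw [h' χ, mul_zero]] at this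
  exact mul_ne_zero (Nat.cast_ne_zero.2 (NeZero.ne p)) h this.symm

/-! ### Invariant polynomials -/

/-- The invariants `x₀x₁x₂, x₁ᵖ, x₂ᵖ`. -/
def invariants (p : ℕ) (x : Fin 3 → ℂ) : Fin 3 → ℂ := ![x 0 * x 1 * x 2, x 1 ^ p, x 2 ^ p]

theorem weight_three {M : Type*} [AddCommMonoid M] (w : Fin 3 → M) (a : Fin 3 →₀ ℕ) :
    Finsupp.weight w a = a 0 • w 0 + a 1 • w 1 + a 2 • w 2 := by
  rw [Finsupp.weight_apply, Finsupp.sum_fintype _ _ (by simp), Fin.sum_univ_three]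

/-- An invariant monomial, written in terms of the invariants. -/
noncomputable def liftMonomial (p k : ℕ) (a : Fin 3 →₀ ℕ) : MvPolynomial (Fin 3) ℂ :=
  -- The three exponents will be congruent modulo `p`, so a power of `x₀x₁x₂` splits off and `p`-th
  -- powers remain; on the curve `x₀ᵖ` is `-(x₁ᵖᵏ + x₂ᵖᵏ)`.
  X 0 ^ (a 0 % p) * (C (-1) * (X 1 ^ k + X 2 ^ k)) ^ (a 0 / p) * X 1 ^ (a 1 / p) * X 2 ^ (a 2 / p)

theorem isWeightedHomogeneous_liftMonomial (p k : ℕ) (a : Fin 3 →₀ ℕ) :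
    (liftMonomial p k a).IsWeightedHomogeneous ![k, 1, 1]
      ((a 0 % p) * k + (a 0 / p) * k + a 1 / p + a 2 / p) := by
  have h0 : (X 0 : MvPolynomial (Fin 3) ℂ).IsWeightedHomogeneous ![k, 1, 1] k :=
    isWeightedHomogeneous_X ℂ _ 0
  have h1 : (X 1 : MvPolynomial (Fin 3) ℂ).IsWeightedHomogeneous ![k, 1, 1] 1 :=
    isWeightedHomogeneous_X ℂ _ 1
  have h2 : (X 2 : MvPolynomial (Fin 3) ℂ).IsWeightedHomogeneous ![k, 1, 1] 1 :=
    isWeightedHomogeneous_X ℂ _ 2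
  have h := (((h0.pow (a 0 % p)).mul ((((h1.pow k).add (h2.pow k)).C_mul (-1)).pow
    (a 0 / p))).mul (h1.pow (a 1 / p))).mul (h2.pow (a 2 / p))
  simp only [smul_eq_mul, mul_one] at h
  exact h

/-- Invariance gives `a 1 ≡ a 0` modulo `p` for each monomial. Since `k ≡ -2`, divisibility of the
degree by `p` then gives `a 2 ≡ a 0`, so `liftMonomial` applies term by term. -/
theorem exists_eval_invariants [NeZero p] (hpk : p * k = k + 2) {N : ℕ}
    {F : MvPolynomial (Fin 3) ℂ} (hF : F.IsWeightedHomogeneous ![k, 1, 1] N)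
    (hN : (N : ZMod p) = 0) (hF' : F.IsWeightedHomogeneous (charWeight p) 0) :
    ∃ H : MvPolynomial (Fin 3) ℂ, H.IsWeightedHomogeneous ![k, 1, 1] (N / p) ∧
      ∀ x : Fin 3 → ℂ, x 0 ^ p + x 1 ^ (p * k) + x 2 ^ (p * k) = 0 →
        eval x F = eval (invariants p x) H := by
  have hT : ∀ a ∈ F.support, a 1 % p = a 0 % p ∧ a 2 % p = a 0 % p ∧
      (a 0 % p) * k + (a 0 / p) * k + a 1 / p + a 2 / p = N / p := by
    intro a ha
    have h1 := hF (mem_support_iff.1 ha)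
    have h2 := hF' (mem_support_iff.1 ha)
    rw [weight_three] at h1 h2
    simp only [charWeight, Matrix.cons_val, smul_eq_mul, nsmul_eq_mul] at h1 h2
    have hpk' : (k : ZMod p) + 2 = 0 := by
      have := congrArg (Nat.cast : ℕ → ZMod p) hpk
      push_cast at this
      rw [← this, ZMod.natCast_self, zero_mul]
    have h3 : (a 1 : ZMod p) = a 0 := by linear_combination h2
    have h4 : (a 2 : ZMod p) = a 0 := by
      rw [← h1] at hN
      push_cast at hN
      linear_combination hN - h3 - (a 0 : ZMod p) * hpk'
    have h5 := (ZMod.natCast_eq_natCast_iff' _ _ _).1 h3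
    have h6 := (ZMod.natCast_eq_natCast_iff' _ _ _).1 h4
    refine ⟨h5, h6, ?_⟩
    refine (Nat.div_eq_of_eq_mul_right (Nat.pos_of_neZero p) ?_).symm
    have e0 := Nat.div_add_mod (a 0) p
    have e1 := Nat.div_add_mod (a 1) p
    have e2 := Nat.div_add_mod (a 2) p
    rw [h5] at e1
    rw [h6] at e2
    rw [← h1]
    generalize a 0 % p = r at *
    calc a 0 * k + a 1 * 1 + a 2 * 1 = (p * (a 0 / p) + r) * k + (p * (a 1 / p) + r)
          + (p * (a 2 / p) + r) := by rw [e0, e1, e2]; ring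
      _ = r * (k + 2) + p * ((a 0 / p) * k + a 1 / p + a 2 / p) := by ring
      _ = _ := by rw [← hpk]; ring
  refine ⟨∑ a ∈ F.support, C (F.coeff a) * liftMonomial p k a, ?_, fun x hx => ?_⟩
  · refine IsWeightedHomogeneous.sum _ _ _ fun a ha => IsWeightedHomogeneous.C_mul ?_ _
    rw [← (hT a ha).2.2]
    exact isWeightedHomogeneous_liftMonomial p k a
  · conv_lhs => rw [F.as_sum, map_sum]
    rw [map_sum]
    refine Finset.sum_congr rfl fun a ha => ?_
    obtain ⟨h1, h2, -⟩ := hT a ha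
    rw [eval_monomial, Finsupp.prod_fintype _ _ (by simp), Fin.prod_univ_three]
    have hx0 : x 0 ^ p = -(x 1 ^ (p * k) + x 2 ^ (p * k)) := by linear_combination hx
    have e : ∀ i, x i ^ a i = x i ^ (a i % p) * (x i ^ p) ^ (a i / p) := fun i => by
      rw [← pow_mul, ← pow_add, Nat.mod_add_div]
    rw [e 0, e 1, e 2, h1, h2, hx0]
    simp only [liftMonomial, invariants, map_mul, eval_C, map_pow, eval_X, map_add, Matrix.cons_val, pow_mul]
    ring

/-- The conditions are two linear congruences on the exponents. If only two of the exponents may be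
nonzero, the determinant is `±1` modulo `p` for every choice of the pair, because `k ≡ -2`; so two
nonzero coordinates suffice. -/
theorem exists_monomial_ne_zero [NeZero p] (hpk : p * k = k + 2) (l : ZMod p) (m : ℕ)
    {x : Fin 3 → ℂ} (hx : (x 0 ≠ 0 ∧ x 1 ≠ 0) ∨ (x 0 ≠ 0 ∧ x 2 ≠ 0) ∨ (x 1 ≠ 0 ∧ x 2 ≠ 0)) :
    ∃ e : Fin 3 → ℕ, x 0 ^ e 0 * x 1 ^ e 1 * x 2 ^ e 2 ≠ 0 ∧ (e 1 - e 0 + l : ZMod p) = 0 ∧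
      ((e 0 * k + e 1 + e 2 + m : ℕ) : ZMod p) = 0 := by
  have hpk' : (k : ZMod p) + 2 = 0 := by
    have := congrArg (Nat.cast : ℕ → ZMod p) hpk
    push_cast at this
    rw [← this, ZMod.natCast_self, zero_mul]
  rcases hx with ⟨h, h'⟩ | ⟨h, h'⟩ | ⟨h, h'⟩
  · refine ⟨![(m - l : ZMod p).val, (m - 2 * l : ZMod p).val, 0], by simp [h, h'], ?_, ?_⟩
    · simp only [Matrix.cons_val, ZMod.natCast_val, ZMod.cast_id]
      ring
    · simp only [Matrix.cons_val, ZMod.natCast_val, ZMod.cast_id, Nat.cast_add, Nat.cast_mul,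
        Nat.cast_zero]
      linear_combination (m - l) * hpk'
  · refine ⟨![l.val, 0, (-m - k * l : ZMod p).val], by simp [h, h'], ?_, ?_⟩
    · simp only [Matrix.cons_val, ZMod.natCast_val, ZMod.cast_id, Nat.cast_zero]
      ring
    · simp only [Matrix.cons_val, ZMod.natCast_val, ZMod.cast_id, Nat.cast_add, Nat.cast_mul,
        Nat.cast_zero]
      ring
  · refine ⟨![0, (-l).val, (-m + l : ZMod p).val], by simp [h, h'], ?_, ?_⟩
    · simp only [Matrix.cons_val, ZMod.natCast_val, ZMod.cast_id, Nat.cast_zero]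
      ring
    · simp only [Matrix.cons_val, ZMod.natCast_val, ZMod.cast_id, Nat.cast_add, Nat.cast_mul,
        Nat.cast_zero]
      ring

/-- The monomial `M` is chosen before `F`, so that the same one can be used for numerator and
denominator of a fraction. -/
theorem exists_mul_isotypic [NeZero p] (hpk : p * k = k + 2) (l : ZMod p) (m : ℕ)
    {x : Fin 3 → ℂ} (hx : (x 0 ≠ 0 ∧ x 1 ≠ 0) ∨ (x 0 ≠ 0 ∧ x 2 ≠ 0) ∨ (x 1 ≠ 0 ∧ x 2 ≠ 0)) :
    ∃ (M : MvPolynomial (Fin 3) ℂ) (N : ℕ), eval x M ≠ 0 ∧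
      ∀ F : MvPolynomial (Fin 3) ℂ, F.IsWeightedHomogeneous ![k, 1, 1] m →
        ∃ H : MvPolynomial (Fin 3) ℂ, H.IsWeightedHomogeneous ![k, 1, 1] N ∧
          ∀ y : Fin 3 → ℂ, y 0 ^ p + y 1 ^ (p * k) + y 2 ^ (p * k) = 0 →
            eval y M * eval y (isotypic l F) = eval (invariants p y) H := by
  obtain ⟨e, he, hl, hm⟩ := exists_monomial_ne_zero hpk l m hx
  refine ⟨X 0 ^ e 0 * X 1 ^ e 1 * X 2 ^ e 2, (e 0 * k + e 1 + e 2 + m) / p, by simpa using he,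
    fun F hF => ?_⟩
  have hM : ∀ {R : Type} [AddCommMonoid R] (w : Fin 3 → R),
      (X 0 ^ e 0 * X 1 ^ e 1 * X 2 ^ e 2 : MvPolynomial (Fin 3) ℂ).IsWeightedHomogeneous w
        (e 0 • w 0 + e 1 • w 1 + e 2 • w 2) := fun w =>
    (((isWeightedHomogeneous_X ℂ w 0).pow _).mul ((isWeightedHomogeneous_X ℂ w 1).pow _)).mul
      ((isWeightedHomogeneous_X ℂ w 2).pow _)
  have h1 := (hM ![k, 1, 1]).mul (isWeightedHomogeneous_isotypic hF l)
  have h2 := (hM (charWeight p)).mul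
    (weightedHomogeneousComponent_isWeightedHomogeneous (w := charWeight p) l F)
  have e1 : e 0 • (![k, 1, 1] : Fin 3 → ℕ) 0 + e 1 • (![k, 1, 1] : Fin 3 → ℕ) 1 +
      e 2 • (![k, 1, 1] : Fin 3 → ℕ) 2 + m = e 0 * k + e 1 + e 2 + m := by simp
  have e2 : e 0 • charWeight p 0 + e 1 • charWeight p 1 + e 2 • charWeight p 2 + l = 0 := by
    rw [← hl]
    simp [charWeight]
    ring
  rw [e1] at h1
  rw [e2] at h2
  obtain ⟨H, hH, h⟩ := exists_eval_invariants hpk h1 hm h2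
  exact ⟨H, hH, fun y hy => by rw [← h y hy, ← map_mul]⟩

end CyclicQuotient

/-! ### The quotient of `x₀ᵖ + x₁ᵖᵏ + x₂ᵖᵏ = 0` by the maps `(μ⁻¹, μ, 1)` -/

/-- The weights and the potential `x₀ᵖ + x₁ᵖᵏ + x₂ᵖᵏ`. -/
structure IsFermat (p k : ℕ) (A : Matrix (Fin 3) (Fin 3) ℕ) : Prop where
  weights_eq : weights A = ![k, 1, 1]
  eval_eq : ∀ x, eval x (potential A) = x 0 ^ p + x 1 ^ (p * k) + x 2 ^ (p * k)

/-- The weights and the potential `x₀ᵖ + x₁ᵏ⁺¹x₂ + x₁x₂ᵏ⁺¹`. -/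
structure IsFermatQuotient (p k : ℕ) (B : Matrix (Fin 3) (Fin 3) ℕ) : Prop where
  weights_eq : weights B = ![k, 1, 1]
  eval_eq : ∀ x, eval x (potential B) = x 0 ^ p + x 1 ^ (k + 1) * x 2 + x 1 * x 2 ^ (k + 1)

theorem fin_three_ne_zero_iff {x : Fin 3 → ℂ} : x ≠ 0 ↔ x 0 ≠ 0 ∨ x 1 ≠ 0 ∨ x 2 ≠ 0 := by
  rw [Function.ne_iff, Fin.exists_fin_succ, Fin.exists_fin_two]
  rfl

theorem weightedEquiv_three {a b c : ℕ} {x y : Fin 3 → ℂ} :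
    WeightedEquiv ![a, b, c] x y ↔
      ∃ t : ℂ, t ≠ 0 ∧ y 0 = t ^ a * x 0 ∧ y 1 = t ^ b * x 1 ∧ y 2 = t ^ c * x 2 := by
  constructor
  · rintro ⟨t, ht⟩
    exact ⟨t, t.ne_zero, ht 0, ht 1, ht 2⟩
  · rintro ⟨t, ht, h0, h1, h2⟩
    refine ⟨Units.mk0 t ht, fun i => ?_⟩
    fin_cases i
    exacts [h0, h1, h2]

section CyclicQuotient

variable {p k : ℕ} {A B : Matrix (Fin 3) (Fin 3) ℕ}

/-! ### The map given by the invariants: surjectivity and fibres -/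

theorem IsFermat.eq_zero (hA : IsFermat p k A) (x : Cone A) :
    x.1 0 ^ p + x.1 1 ^ (p * k) + x.1 2 ^ (p * k) = 0 :=
  (hA.eval_eq x.1).symm.trans x.2.2

theorem pow_pow_swap_mul (hpk : p * k = k + 2) (t : ℂ) : (t ^ p) ^ k = t ^ k * t * t := by
  rw [← pow_mul, hpk]
  ring

theorem addChar_pow_eq_one (χ : AddChar (ZMod p) ℂ) (a : ZMod p) : χ a ^ p = 1 := by
  rw [← AddChar.map_nsmul_eq_pow, nsmul_eq_mul, ZMod.natCast_self, zero_mul,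
    AddChar.map_zero_eq_one]

theorem charMul_eq (χ : AddChar (ZMod p) ℂ) (x : Fin 3 → ℂ) :
    charMul χ x = ![(χ 1)⁻¹ * x 0, χ 1 * x 1, x 2] := by
  funext i
  fin_cases i <;> simp [charMul, charWeight, AddChar.map_neg_eq_inv]

variable [NeZero p]

theorem IsFermat.two_ne_zero (hA : IsFermat p k A) (hpk : p * k = k + 2) (x : Cone A) :
    (x.1 0 ≠ 0 ∧ x.1 1 ≠ 0) ∨ (x.1 0 ≠ 0 ∧ x.1 2 ≠ 0) ∨ (x.1 1 ≠ 0 ∧ x.1 2 ≠ 0) := by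
  have h := hA.eq_zero x
  have hp := NeZero.ne p
  have hx := fin_three_ne_zero_iff.1 x.2.1
  by_cases h0 : x.1 0 = 0 <;> by_cases h1 : x.1 1 = 0 <;> by_cases h2 : x.1 2 = 0 <;>
    simp_all [zero_pow hp]

/-- The map given by the invariants, on the cones. -/
def coneInvariants (hA : IsFermat p k A) (hB : IsFermatQuotient p k B) (hpk : p * k = k + 2)
    (x : Cone A) : Cone B :=
  ⟨invariants p x.1, by
    have hp := NeZero.ne p
    rw [fin_three_ne_zero_iff]
    rcases hA.two_ne_zero hpk x with h | h | h <;> simp [invariants, h], by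
    rw [hB.eval_eq]
    simp only [invariants, Matrix.cons_val]
    linear_combination (x.1 1 ^ p * x.1 2 ^ p) * hA.eq_zero x⟩

theorem coneInvariants_val (hA : IsFermat p k A) (hB : IsFermatQuotient p k B)
    (hpk : p * k = k + 2) (x : Cone A) : (coneInvariants hA hB hpk x).1 = invariants p x.1 := rfl

/-- The map given by the invariants. -/
def mapInvariants (hA : IsFermat p k A) (hB : IsFermatQuotient p k B) (hpk : p * k = k + 2) :
    Points A → Points B :=
  Quotient.map (coneInvariants hA hB hpk) fun x y h => by
    change WeightedEquiv _ _ _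
    replace h : WeightedEquiv (weights A) x.1 y.1 := h
    rw [hA.weights_eq, weightedEquiv_three] at h
    obtain ⟨t, ht, h0, h1, h2⟩ := h
    rw [hB.weights_eq, weightedEquiv_three]
    refine ⟨t ^ p, pow_ne_zero _ ht, ?_, ?_, ?_⟩ <;>
      simp only [coneInvariants, invariants, Matrix.cons_val, h0, h1, h2, pow_pow_swap_mul hpk] <;>
      ring

theorem mapInvariants_mk (hA : IsFermat p k A) (hB : IsFermatQuotient p k B)
    (hpk : p * k = k + 2) (x : Cone A) :
    mapInvariants hA hB hpk (Points.mk x) = Points.mk (coneInvariants hA hB hpk x) := rfl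

theorem isMorphism_mapInvariants (hA : IsFermat p k A) (hB : IsFermatQuotient p k B)
    (hpk : p * k = k + 2) : IsMorphism (mapInvariants hA hB hpk) := by
  have h0 : (X 0 : MvPolynomial (Fin 3) ℂ).IsWeightedHomogeneous ![k, 1, 1] k :=
    isWeightedHomogeneous_X ℂ _ 0
  have h1 : (X 1 : MvPolynomial (Fin 3) ℂ).IsWeightedHomogeneous ![k, 1, 1] 1 :=
    isWeightedHomogeneous_X ℂ _ 1
  have h2 : (X 2 : MvPolynomial (Fin 3) ℂ).IsWeightedHomogeneous ![k, 1, 1] 1 :=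
    isWeightedHomogeneous_X ℂ _ 2
  have he : ∀ x : Cone A, (fun j => eval x.1 ((![X 0 * X 1 * X 2, X 1 ^ p, X 2 ^ p] :
      Fin 3 → MvPolynomial (Fin 3) ℂ) j)) = (coneInvariants hA hB hpk x).1 := fun x => by
    funext j
    fin_cases j <;> simp [coneInvariants, invariants]
  refine fun x => ⟨p, ![X 0 * X 1 * X 2, X 1 ^ p, X 2 ^ p], fun j => ?_, ?_, fun y _ =>
    ⟨coneInvariants hA hB hpk y, (he y).symm, rfl⟩⟩
  · rw [hA.weights_eq, hB.weights_eq]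
    fin_cases j
    · simpa [hpk] using (h0.mul h1).mul h2
    · simpa using h1.pow p
    · simpa using h2.pow p
  · rw [he]
    exact (coneInvariants hA hB hpk x).2.1

theorem exists_coneInvariants_eq (hA : IsFermat p k A) (hB : IsFermatQuotient p k B)
    (hpk : p * k = k + 2) (z : Cone B) : ∃ x : Cone A, coneInvariants hA hB hpk x = z := by
  have hp := NeZero.ne p
  have hz := z.2.2
  rw [hB.eval_eq] at hz
  obtain ⟨u, hu⟩ := IsAlgClosed.exists_pow_nat_eq (z.1 1) (Nat.pos_of_neZero p)
  obtain ⟨v, hv⟩ := IsAlgClosed.exists_pow_nat_eq (z.1 2) (Nat.pos_of_neZero p)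
  obtain ⟨r, hr⟩ := IsAlgClosed.exists_pow_nat_eq (-(u ^ (p * k) + v ^ (p * k)))
    (Nat.pos_of_neZero p)
  have h1 : (r * u * v) ^ p = z.1 0 ^ p := by
    rw [mul_pow, mul_pow, hr, hu, hv, pow_mul, pow_mul, hu, hv]
    linear_combination -hz
  -- The root `r` is determined only up to a `p`-th root of unity; the correct choice is obtained by
  -- multiplying it by the ratio of `z₀` to `ruv`, which is such a root of unity.
  obtain ⟨s, hs, hs'⟩ : ∃ s, s ^ p = r ^ p ∧ s * u * v = z.1 0 := by
    by_cases h : r * u * v = 0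
    · refine ⟨r, rfl, ?_⟩
      rw [h, zero_pow hp, eq_comm, pow_eq_zero_iff hp] at h1
      rw [h, h1]
    · refine ⟨z.1 0 / (r * u * v) * r, ?_, ?_⟩
      · rw [mul_pow, div_pow, ← h1, div_self (pow_ne_zero _ h), one_mul]
      · rw [mul_assoc, mul_assoc, ← mul_assoc r, div_mul_cancel₀ _ h]
  have h2 : invariants p ![s, u, v] = z.1 := by
    funext i
    fin_cases i
    exacts [hs', hu, hv]
  refine ⟨⟨![s, u, v], fun h => z.2.1 ?_, ?_⟩, Subtype.ext h2⟩
  · rw [← h2, h]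
    funext i
    fin_cases i <;> simp [invariants, hp]
  · rw [hA.eval_eq]
    simp only [Matrix.cons_val, hs, hr]
    ring

theorem mapInvariants_surjective (hA : IsFermat p k A) (hB : IsFermatQuotient p k B)
    (hpk : p * k = k + 2) : Function.Surjective (mapInvariants hA hB hpk) := fun q => by
  obtain ⟨z, rfl⟩ := q.exists_rep
  obtain ⟨x, rfl⟩ := exists_coneInvariants_eq hA hB hpk z
  exact ⟨_, mapInvariants_mk hA hB hpk x⟩

/-- The action of the maps `(μ⁻¹, μ, 1)` on the cone. -/
noncomputable def coneCharMul (hA : IsFermat p k A) (χ : AddChar (ZMod p) ℂ) (x : Cone A) :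
    Cone A :=
  ⟨charMul χ x.1, fun h => x.2.1 (funext fun i => by
      have hu := (IsUnit.of_pow_eq_one (addChar_pow_eq_one χ (charWeight p i))
        (NeZero.ne p)).ne_zero
      exact (mul_eq_zero_iff_left hu).1 (congrFun h i)), by
    have h1 := addChar_pow_eq_one χ 1
    have h2 := hA.eq_zero x
    rw [pow_mul, pow_mul] at h2
    rw [hA.eval_eq, charMul_eq]
    simp [mul_pow, pow_mul, h1, h2]⟩

theorem coneCharMul_val (hA : IsFermat p k A) (χ : AddChar (ZMod p) ℂ) (x : Cone A) :
    (coneCharMul hA χ x).1 = charMul χ x.1 := rfl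

theorem mapInvariants_coneCharMul (hA : IsFermat p k A) (hB : IsFermatQuotient p k B)
    (hpk : p * k = k + 2) (χ : AddChar (ZMod p) ℂ) (x : Cone A) :
    mapInvariants hA hB hpk (Points.mk (coneCharMul hA χ x)) =
      mapInvariants hA hB hpk (Points.mk x) := by
  rw [mapInvariants_mk, mapInvariants_mk]
  refine congrArg Points.mk (Subtype.ext ?_)
  have h1 := addChar_pow_eq_one χ 1
  have h2 : χ 1 ≠ 0 := (IsUnit.of_pow_eq_one h1 (NeZero.ne p)).ne_zero
  funext i
  fin_cases i
  · simp [coneInvariants, coneCharMul, charMul_eq, invariants]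
    left
    field_simp
  · simp [coneInvariants, coneCharMul, charMul_eq, invariants, mul_pow, h1]
  · simp [coneInvariants, coneCharMul, charMul_eq, invariants]

/-- After scaling by `σ`, the coordinates of `x` and `y` differ by `p`-th roots of unity `α, β, γ`;
for the zeroth coordinate this uses the equation of the curve. The value of `x₀x₁x₂` forces `αβγ =
1` unless a coordinate vanishes, and a vanishing coordinate removes one of the conditions on `t` and
`μ`. Throughout, `ωᵏ⁺² = 1` when `ωᵖ = 1`. -/
theorem exists_coneCharMul_eq (hA : IsFermat p k A) (hB : IsFermatQuotient p k B)
    (hpk : p * k = k + 2) {x y : Cone A}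
    (h : mapInvariants hA hB hpk (Points.mk x) = mapInvariants hA hB hpk (Points.mk y)) :
    ∃ χ : AddChar (ZMod p) ℂ, Points.mk (coneCharMul hA χ x) = Points.mk y := by
  have hp := NeZero.ne p
  suffices ∃ t μ : ℂ, t ≠ 0 ∧ μ ^ p = 1 ∧ y.1 0 = t ^ k * (μ⁻¹ * x.1 0) ∧
      y.1 1 = t * (μ * x.1 1) ∧ y.1 2 = t * x.1 2 by
    obtain ⟨t, μ, ht, hμ, h0, h1, h2⟩ := this
    refine ⟨AddChar.zmodChar p hμ, ?_⟩
    rw [Points.mk_eq_mk, hA.weights_eq, weightedEquiv_three]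
    have hμ' : AddChar.zmodChar p hμ 1 = μ := by
      simpa using AddChar.zmodChar_apply' hμ 1
    refine ⟨t, ht, ?_, ?_, ?_⟩ <;> simp [coneCharMul, charMul_eq, hμ', h0, h1, h2]
  rw [mapInvariants_mk, mapInvariants_mk, Points.mk_eq_mk, hB.weights_eq,
    weightedEquiv_three] at h
  obtain ⟨s, hs, h0, h1, h2⟩ := h
  simp only [coneInvariants, invariants, Matrix.cons_val, pow_one] at h0 h1 h2
  obtain ⟨σ, rfl⟩ := IsAlgClosed.exists_pow_nat_eq s (Nat.pos_of_neZero p)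
  have hσ : σ ≠ 0 := fun h => hs (by rw [h, zero_pow hp])
  have hroot : ∀ a b : ℂ, a ^ p = b ^ p → ∃ ω : ℂ, ω ^ p = 1 ∧ a = ω * b := fun a b hab => by
    by_cases hb : b = 0
    · rw [hb, zero_pow hp, pow_eq_zero_iff hp] at hab
      exact ⟨1, one_pow p, by rw [hab, hb, mul_zero]⟩
    · exact ⟨a / b, by rw [div_pow, hab, div_self (pow_ne_zero _ hb)], by field_simp⟩
  obtain ⟨β, hβ, e1⟩ := hroot (y.1 1) (σ * x.1 1) (by rw [h1, mul_pow])
  obtain ⟨γ, hγ, e2⟩ := hroot (y.1 2) (σ * x.1 2) (by rw [h2, mul_pow])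
  obtain ⟨α, hα, e0⟩ := hroot (y.1 0) (σ ^ k * x.1 0) (by
    have hx := hA.eq_zero x
    have hy := hA.eq_zero y
    rw [pow_mul, pow_mul, h1, h2] at hy
    rw [pow_mul, pow_mul] at hx
    rw [mul_pow, ← pow_mul, mul_comm k p, pow_mul]
    linear_combination hy - (σ ^ p) ^ k * hx)
  have hne : ∀ {ω : ℂ}, ω ^ p = 1 → ω ≠ 0 := fun hω => (IsUnit.of_pow_eq_one hω hp).ne_zero
  have hα0 := hne hα
  have hβ0 := hne hβ
  have hγ0 := hne hγ
  have hk : ∀ {ω : ℂ}, ω ^ p = 1 → ω ^ k * ω * ω = 1 := fun hω => by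
    rw [← pow_pow_swap_mul hpk, hω, one_pow]
  have hαβγ : (α * β * γ - 1) * (x.1 0 * x.1 1 * x.1 2) = 0 := by
    rw [e0, e1, e2, pow_pow_swap_mul hpk] at h0
    have : (σ ^ k * σ * σ) ≠ 0 := by simp [hσ]
    rw [← mul_eq_zero_iff_left this]
    linear_combination h0
  have hcases : α * β * γ = 1 ∨ x.1 0 = 0 ∨ x.1 1 = 0 ∨ x.1 2 = 0 := by
    simpa [sub_eq_zero, or_assoc] using hαβγ
  rcases hcases with h | h | h | h
  · refine ⟨σ * γ, β / γ, mul_ne_zero hσ hγ0, by rw [div_pow, hβ, hγ, div_one], ?_, ?_, ?_⟩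
    · rw [e0, mul_pow, inv_div]
      have h3 := hk hγ
      field_simp
      linear_combination (γ ^ k * γ * x.1 0) * h - α * β * x.1 0 * h3
    · rw [e1]; field_simp
    · rw [e2]; ring
  · refine ⟨σ * γ, β / γ, mul_ne_zero hσ hγ0, by rw [div_pow, hβ, hγ, div_one], ?_, ?_, ?_⟩
    · rw [e0, h]; simp
    · rw [e1]; field_simp
    · rw [e2]; ring
  -- With `x₁ = 0` only the outer coordinates constrain: `t = σγ` and `tᵏμ⁻¹ = σᵏα`.
  · refine ⟨σ * γ, γ ^ k / α, mul_ne_zero hσ hγ0, ?_, ?_, ?_, ?_⟩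
    · rw [div_pow, hα, ← pow_mul, mul_comm, pow_mul, hγ, one_pow, div_one]
    · rw [e0, mul_pow, inv_div]; field_simp
    · rw [e1, h]; simp
    · rw [e2]; ring
  -- With `x₂ = 0` the conditions are `tμ = σβ` and `tᵏμ⁻¹ = σᵏα`; multiplying them and using `ωᵏ⁺²
  -- = 1` suggests `t = σ(αβ)⁻¹`.
  · refine ⟨σ * (α * β)⁻¹, β ^ 2 * α, by simp [hσ, hα0, hβ0], ?_, ?_, ?_, ?_⟩
    · rw [mul_pow, ← pow_mul, mul_comm 2, pow_mul, hα, hβ]; simp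
    · rw [e0, mul_pow, inv_pow, mul_pow]
      have h3 := hk hα
      have h4 := hk hβ
      field_simp
      linear_combination x.1 0 * (α ^ k * α ^ 2 * h4 + h3)
    · rw [e1]; field_simp
    · rw [e2, h]; simp

end CyclicQuotient

/-- The value of `f` is taken at the image of a fixed `y'`, while `y` runs through its whole fibre.
This is the form in which the relation can be averaged over an orbit. -/
theorem exists_fraction_of_regular_comp {n : ℕ} {A B : Matrix (Fin n) (Fin n) ℕ}
    (φ : Points A → Points B) (hφ : Continuous φ) {U : Opens (hypersurface B).space} {f : U → ℂ}
    (hf : (hypersurface A).regular.pred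
      (U := Opens.comap (⟨φ, hφ⟩ : C((hypersurface A).space, (hypersurface B).space)) U)
      (fun x => f ⟨φ x.1, x.2⟩))
    (c : Cone A → Cone B) (hc : ∀ x, φ (Points.mk x) = Points.mk (c x)) (x : Cone A)
    (hx : Points.mk (c x) ∈ U) :
    ∃ (m : ℕ) (F G : MvPolynomial (Fin n) ℂ), F.IsWeightedHomogeneous (weights A) m ∧
      G.IsWeightedHomogeneous (weights A) m ∧ eval x.1 G ≠ 0 ∧
      ∀ (y y' : Cone A) (hy' : Points.mk (c y') ∈ U), φ (Points.mk y) = φ (Points.mk y') →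
        f ⟨Points.mk (c y'), hy'⟩ * eval y.1 G = eval y.1 F := by
  obtain ⟨m, F, G, hF, hG, hGx, h⟩ := regular_hypersurface_iff.1 hf x
    (show φ (Points.mk x) ∈ U from (hc x).symm ▸ hx)
  refine ⟨m, F, G, hF, hG, hGx, fun y y' hy' hyy' => ?_⟩
  have h1 : φ (Points.mk y) = Points.mk (c y') := hyy'.trans (hc y')
  rw [← h y (show φ (Points.mk y) ∈ U from h1.symm ▸ hy')]
  congr 2
  exact Subtype.ext h1.symm

section CyclicQuotient

variable {p k : ℕ} [NeZero p] {A B : Matrix (Fin 3) (Fin 3) ℕ}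

/-- Some isotypic part of `F` is nonzero at `x` and, times a monomial, descends to `H`. Where `H` is
nonzero, `F` is nonzero at some point of the fibre, which is enough to be in `U`. -/
theorem isOpen_of_isOpen_preimage_mapInvariants (hA : IsFermat p k A)
    (hB : IsFermatQuotient p k B) (hpk : p * k = k + 2) (U : Set (Points B))
    (hU : IsOpen (mapInvariants hA hB hpk ⁻¹' U)) : IsOpen U := by
  refine isOpen_points_iff.2 fun z hz => ?_
  obtain ⟨x, rfl⟩ := exists_coneInvariants_eq hA hB hpk z
  obtain ⟨m, F, hF, hFx, hFU⟩ := isOpen_points_iff.1 hU x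
    (by rwa [Set.mem_preimage, mapInvariants_mk])
  obtain ⟨l, hl⟩ := exists_isotypic_ne_zero (p := p) hFx
  obtain ⟨M, N, hM, h⟩ := exists_mul_isotypic hpk l m (hA.two_ne_zero hpk x)
  obtain ⟨H, hH, hFH⟩ := h F (by rwa [← hA.weights_eq])
  refine ⟨N, H, by rwa [hB.weights_eq], ?_, fun z' hz' => ?_⟩
  · rw [coneInvariants_val, ← hFH x.1 (hA.eq_zero x)]
    exact mul_ne_zero hM hl
  · obtain ⟨y, rfl⟩ := exists_coneInvariants_eq hA hB hpk z'
    rw [coneInvariants_val, ← hFH y.1 (hA.eq_zero y)] at hz'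
    obtain ⟨χ, hχ⟩ := exists_charMul_ne_zero (right_ne_zero_of_mul hz')
    rw [← coneCharMul_val hA] at hχ
    have h2 := hFU _ hχ
    rwa [Set.mem_preimage, mapInvariants_coneCharMul, mapInvariants_mk] at h2

/-- The relation `f * G = F` holds along orbits with constant `f`, so it passes to the `l`-isotypic
parts, with `l` chosen so that the part of `G` is nonzero at `x`. A common monomial factor makes
both parts descend. -/
theorem regular_mapInvariants_iff (hA : IsFermat p k A) (hB : IsFermatQuotient p k B)
    (hpk : p * k = k + 2) (U : Opens (hypersurface B).space) (f : U → ℂ) :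
    (hypersurface B).regular.pred f ↔ (hypersurface A).regular.pred
      (U := Opens.comap (⟨mapInvariants hA hB hpk, (isMorphism_mapInvariants hA hB hpk).continuous⟩ :
        C((hypersurface A).space, (hypersurface B).space)) U)
      (fun x => f ⟨mapInvariants hA hB hpk x.1, x.2⟩) := by
  refine ⟨(isMorphism_mapInvariants hA hB hpk).regular_comp U, fun hf =>
    regular_hypersurface_iff.2 fun z hz => ?_⟩
  have hreg := exists_fraction_of_regular_comp _ _ hf _ (mapInvariants_mk hA hB hpk)
  obtain ⟨x, rfl⟩ := exists_coneInvariants_eq hA hB hpk z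
  obtain ⟨m, F, G, hF, hG, hGx, hFG⟩ := hreg x hz
  obtain ⟨l, hl⟩ := exists_isotypic_ne_zero (p := p) hGx
  obtain ⟨M, N, hM, h⟩ := exists_mul_isotypic hpk l m (hA.two_ne_zero hpk x)
  obtain ⟨F', hF', hFF'⟩ := h F (by rwa [← hA.weights_eq])
  obtain ⟨G', hG', hGG'⟩ := h G (by rwa [← hA.weights_eq])
  refine ⟨N, F', G', by rwa [hB.weights_eq], by rwa [hB.weights_eq], ?_, fun z' hz' => ?_⟩
  · rw [coneInvariants_val, ← hGG' x.1 (hA.eq_zero x)]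
    exact mul_ne_zero hM hl
  · obtain ⟨y, rfl⟩ := exists_coneInvariants_eq hA hB hpk z'
    have h1 : ∀ χ : AddChar (ZMod p) ℂ, f ⟨_, hz'⟩ * eval (charMul χ y.1) G =
        eval (charMul χ y.1) F := fun χ => by
      rw [← coneCharMul_val hA]
      exact hFG _ y hz' (mapInvariants_coneCharMul hA hB hpk χ y)
    have h3 : f ⟨_, hz'⟩ * eval y.1 (isotypic l G) = eval y.1 (isotypic l F) := by
      have hp : (p : ℂ) ≠ 0 := Nat.cast_ne_zero.2 (NeZero.ne p)
      refine mul_left_cancel₀ hp ?_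
      rw [mul_left_comm, ← sum_eval_charMul, ← sum_eval_charMul, Finset.mul_sum]
      exact Finset.sum_congr rfl fun χ _ => by rw [mul_left_comm, h1]
    rw [coneInvariants_val,
      ← hFF' y.1 (hA.eq_zero y), ← hGG' y.1 (hA.eq_zero y), ← h3, mul_left_comm]

/-- The quotient of `x₀ᵖ + x₁ᵖᵏ + x₂ᵖᵏ = 0` by the maps `(μ⁻¹, μ, 1)`. -/
noncomputable def fermatQuotientIso (hA : IsFermat p k A) (hB : IsFermatQuotient p k B)
    (hpk : p * k = k + 2) (G : Type) [Group G] [MulAction G (hypersurface A).space]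
    (horb : ∀ x y : Cone A,
      (∃ g : G, HSMul.hSMul (β := (hypersurface A).space) (γ := (hypersurface A).space) g
        (Points.mk x) = Points.mk y) ↔
        ∃ χ : AddChar (ZMod p) ℂ, Points.mk (coneCharMul hA χ x) = Points.mk y) :
    FunctionSpace.Iso ((hypersurface A).quotient G) (hypersurface B) :=
  quotientIso (X := hypersurface A) (Y := hypersurface B) G (mapInvariants hA hB hpk)
    (mapInvariants_surjective hA hB hpk)
    (fun a b => by
      obtain ⟨x, rfl⟩ := Points.exists_rep a
      obtain ⟨y, rfl⟩ := Points.exists_rep b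
      refine (horb x y).trans ⟨?_, exists_coneCharMul_eq hA hB hpk⟩
      rintro ⟨χ, hχ⟩
      rw [← hχ, mapInvariants_coneCharMul])
    (isMorphism_mapInvariants hA hB hpk).continuous
    (isOpen_of_isOpen_preimage_mapInvariants hA hB hpk)
    (regular_mapInvariants_iff hA hB hpk)

end CyclicQuotient

/-! ### Isomorphisms between the curves with `j`-invariant 1728 -/

section Polynomial

variable {n : ℕ} {A B : Matrix (Fin n) (Fin n) ℕ}

/-- The map of points given by weighted homogeneous polynomials without common zeros. -/
def mapOfPolynomials (c : Cone A → Cone B) (e : ℕ) (P : Fin n → MvPolynomial (Fin n) ℂ)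
    (hP : ∀ j, (P j).IsWeightedHomogeneous (weights A) (e * weights B j))
    (hc : ∀ x, (c x).1 = fun j => eval x.1 (P j)) : Points A → Points B :=
  Quotient.map c fun x y h => by
    obtain ⟨t, ht⟩ := h
    refine ⟨t ^ e, fun j => ?_⟩
    rw [hc, hc, funext ht]
    simp only [eval_pow_mul (hP j), Units.val_pow_eq_pow_val, pow_mul]

theorem isMorphism_mapOfPolynomials (c : Cone A → Cone B) (e : ℕ)
    (P : Fin n → MvPolynomial (Fin n) ℂ)
    (hP : ∀ j, (P j).IsWeightedHomogeneous (weights A) (e * weights B j))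
    (hc : ∀ x, (c x).1 = fun j => eval x.1 (P j)) : IsMorphism (mapOfPolynomials c e P hP hc) :=
  fun x => ⟨e, P, hP, hc x ▸ (c x).2.1, fun y _ => ⟨c y, hc y, rfl⟩⟩

theorem mapOfPolynomials_mk (c : Cone A → Cone B) (e : ℕ)
    (P : Fin n → MvPolynomial (Fin n) ℂ)
    (hP : ∀ j, (P j).IsWeightedHomogeneous (weights A) (e * weights B j))
    (hc : ∀ x, (c x).1 = fun j => eval x.1 (P j)) (x : Cone A) :
    mapOfPolynomials c e P hP hc (Points.mk x) = Points.mk (c x) := rfl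

end Polynomial

variable {A B : Matrix (Fin 3) (Fin 3) ℕ}

theorem isWeightedHomogeneous_three (a b c : ℕ) :
    (X 0 : MvPolynomial (Fin 3) ℂ).IsWeightedHomogeneous ![a, b, c] a ∧
    (X 1 : MvPolynomial (Fin 3) ℂ).IsWeightedHomogeneous ![a, b, c] b ∧
    (X 2 : MvPolynomial (Fin 3) ℂ).IsWeightedHomogeneous ![a, b, c] c :=
  ⟨isWeightedHomogeneous_X ℂ _ 0, isWeightedHomogeneous_X ℂ _ 1, isWeightedHomogeneous_X ℂ _ 2⟩

/-- The curves `x₀² + x₁³x₂ + x₁x₂³ = 0` and `x₀² + x₁⁴ + x₂⁴ = 0` are isomorphic. -/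
theorem nonempty_iso_fermat (hB : IsFermatQuotient 2 2 B) (hA : IsFermat 2 2 A) :
    Nonempty (FunctionSpace.Iso (hypersurface B) (hypersurface A)) := by
  -- Put `x₁ = αu + βv` and `x₂ = αu - βv` in `x₁x₂(x₁² + x₂²)`: the result is `2(α⁴u⁴ - β⁴v⁴)`,
  -- which equals `u⁴ + v⁴` for `α⁴ = 1/2` and `β⁴ = -1/2`.
  obtain ⟨α, hα⟩ := IsAlgClosed.exists_pow_nat_eq (1 / 2 : ℂ) (n := 4) (by norm_num)
  obtain ⟨β, hβ⟩ := IsAlgClosed.exists_pow_nat_eq (-1 / 2 : ℂ) (n := 4) (by norm_num)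
  have hα0 : α ≠ 0 := by rintro rfl; norm_num at hα
  have hβ0 : β ≠ 0 := by rintro rfl; norm_num at hβ
  let f : (Fin 3 → ℂ) → Fin 3 → ℂ := fun x => ![x 0, α * x 1 + β * x 2, α * x 1 - β * x 2]
  let g : (Fin 3 → ℂ) → Fin 3 → ℂ :=
    fun x => ![x 0, (2 * α)⁻¹ * (x 1 + x 2), (2 * β)⁻¹ * (x 1 - x 2)]
  have hfg : ∀ x, f (g x) = x := fun x => by
    funext i
    fin_cases i
    · rfl
    · simp [f, g]; field_simp; ring
    · simp [f, g]; field_simp; ring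
  have hgf : ∀ x, g (f x) = x := fun x => by
    funext i
    fin_cases i
    · rfl
    · simp [f, g]; field_simp; ring
    · simp [f, g]; field_simp; ring
  have f0 : f 0 = 0 := by
    funext i
    fin_cases i <;> simp [f]
  have g0 : g 0 = 0 := by
    funext i
    fin_cases i <;> simp [g]
  have hW : ∀ x, eval (f x) (potential B) = eval x (potential A) := fun x => by
    rw [hA.eval_eq, hB.eval_eq]
    simp only [f, Matrix.cons_val]
    linear_combination (2 * x 1 ^ 4) * hα - (2 * x 2 ^ 4) * hβ
  let c : Cone B → Cone A := fun x => ⟨g x.1, fun h => x.2.1 (by rw [← hfg x.1, h, f0]), by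
    rw [← hW, hfg]
    exact x.2.2⟩
  let d : Cone A → Cone B := fun x => ⟨f x.1, fun h => x.2.1 (by rw [← hgf x.1, h, g0]), by
    rw [hW]
    exact x.2.2⟩
  obtain ⟨h0, h1, h2⟩ := isWeightedHomogeneous_three 2 1 1
  have hP : ∀ j, ((![X 0, C (2 * α)⁻¹ * (X 1 + X 2), C (2 * β)⁻¹ * (X 1 - X 2)] :
      Fin 3 → MvPolynomial (Fin 3) ℂ) j).IsWeightedHomogeneous (weights B) (1 * weights A j) := by
    rw [hA.weights_eq, hB.weights_eq]
    intro j
    fin_cases j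
    exacts [h0, (h1.add h2).C_mul _, (h1.sub h2).C_mul _]
  have hQ : ∀ j, ((![X 0, C α * X 1 + C β * X 2, C α * X 1 - C β * X 2] :
      Fin 3 → MvPolynomial (Fin 3) ℂ) j).IsWeightedHomogeneous (weights A) (1 * weights B j) := by
    rw [hA.weights_eq, hB.weights_eq]
    intro j
    fin_cases j
    exacts [h0, (h1.C_mul α).add (h2.C_mul β), (h1.C_mul α).sub (h2.C_mul β)]
  have hc : ∀ x, (c x).1 = fun j => eval x.1 ((![X 0, C (2 * α)⁻¹ * (X 1 + X 2),
      C (2 * β)⁻¹ * (X 1 - X 2)] : Fin 3 → MvPolynomial (Fin 3) ℂ) j) := fun x => by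
    funext j
    fin_cases j <;> simp [c, g]
  have hd : ∀ x, (d x).1 = fun j => eval x.1 ((![X 0, C α * X 1 + C β * X 2,
      C α * X 1 - C β * X 2] : Fin 3 → MvPolynomial (Fin 3) ℂ) j) := fun x => by
    funext j
    fin_cases j <;> simp [d, f]
  refine ⟨isoOfMorphisms _ _ (isMorphism_mapOfPolynomials c 1 _ hP hc)
    (isMorphism_mapOfPolynomials d 1 _ hQ hd) (fun p => ?_) (fun p => ?_)⟩
  · obtain ⟨x, rfl⟩ := p.exists_rep
    rw [mapOfPolynomials_mk, mapOfPolynomials_mk]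
    exact congrArg Points.mk (Subtype.ext (hfg x.1))
  · obtain ⟨x, rfl⟩ := p.exists_rep
    rw [mapOfPolynomials_mk, mapOfPolynomials_mk]
    exact congrArg Points.mk (Subtype.ext (hgf x.1))

/-- The weights and the potential `x₀²x₁ + x₁²x₂ + x₂³`. -/
structure IsCubicChain (A : Matrix (Fin 3) (Fin 3) ℕ) : Prop where
  weights_eq : weights A = ![1, 1, 1]
  eval_eq : ∀ x, eval x (potential A) = x 0 ^ 2 * x 1 + x 1 ^ 2 * x 2 + x 2 ^ 3

theorem IsCubicChain.eq_zero (hA : IsCubicChain A) (x : Cone A) :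
    x.1 0 ^ 2 * x.1 1 + x.1 1 ^ 2 * x.1 2 + x.1 2 ^ 3 = 0 :=
  (hA.eval_eq x.1).symm.trans x.2.2

theorem IsFermatQuotient.eq_zero {p k : ℕ} (hB : IsFermatQuotient p k B) (x : Cone B) :
    x.1 0 ^ p + x.1 1 ^ (k + 1) * x.1 2 + x.1 1 * x.1 2 ^ (k + 1) = 0 :=
  (hB.eval_eq x.1).symm.trans x.2.2

open Classical in
/-- The map `(x₀x₁, x₁, x₂)`, extended to the point `(1 : 0 : 0)`. -/
noncomputable def chainToQuartic (hA : IsCubicChain A) (hB : IsFermatQuotient 2 2 B) (x : Cone A) :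
    Cone B :=
  if h : x.1 1 = 0 ∧ x.1 2 = 0 then
    ⟨![0, 0, 1], by simp, by simp [hB.eval_eq]⟩
  else ⟨![x.1 0 * x.1 1, x.1 1, x.1 2], by
    rw [fin_three_ne_zero_iff]
    simp only [Matrix.cons_val]
    tauto, by
    rw [hB.eval_eq]
    simp only [Matrix.cons_val]
    linear_combination x.1 1 * hA.eq_zero x⟩

open Classical in
/-- The inverse `(x₀, x₁², x₁x₂)` of `(x₀x₁, x₁, x₂)`, extended to the point `(0 : 0 : 1)`. -/
noncomputable def quarticToChain (hB : IsFermatQuotient 2 2 B) (hA : IsCubicChain A) (x : Cone B) :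
    Cone A :=
  if h : x.1 1 = 0 then
    ⟨![1, 0, 0], by simp, by simp [hA.eval_eq]⟩
  else ⟨![x.1 0, x.1 1 ^ 2, x.1 1 * x.1 2], by
    rw [fin_three_ne_zero_iff]
    simp [h], by
    rw [hA.eval_eq]
    simp only [Matrix.cons_val]
    linear_combination x.1 1 ^ 2 * hB.eq_zero x⟩

theorem chainToQuartic_equiv (hA : IsCubicChain A) (hB : IsFermatQuotient 2 2 B) {x y : Cone A}
    (h : WeightedEquiv (weights A) x.1 y.1) :
    WeightedEquiv (weights B) (chainToQuartic hA hB x).1 (chainToQuartic hA hB y).1 := by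
  rw [hA.weights_eq, weightedEquiv_three] at h
  obtain ⟨t, ht, h0, h1, h2⟩ := h
  rw [hB.weights_eq, weightedEquiv_three]
  unfold chainToQuartic
  by_cases hx : x.1 1 = 0 ∧ x.1 2 = 0
  · rw [dif_pos hx, dif_pos (by simp [h1, h2, hx])]
    exact ⟨1, one_ne_zero, by simp⟩
  · rw [dif_neg hx, dif_neg (by simpa [h1, h2, ht] using hx)]
    refine ⟨t, ht, ?_, ?_, ?_⟩ <;> simp only [Matrix.cons_val, h0, h1, h2]; ring

theorem quarticToChain_equiv (hB : IsFermatQuotient 2 2 B) (hA : IsCubicChain A) {x y : Cone B}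
    (h : WeightedEquiv (weights B) x.1 y.1) :
    WeightedEquiv (weights A) (quarticToChain hB hA x).1 (quarticToChain hB hA y).1 := by
  rw [hB.weights_eq, weightedEquiv_three] at h
  obtain ⟨t, ht, h0, h1, h2⟩ := h
  rw [hA.weights_eq, weightedEquiv_three]
  unfold quarticToChain
  by_cases hx : x.1 1 = 0
  · rw [dif_pos hx, dif_pos (by simp [h1, hx])]
    exact ⟨1, one_ne_zero, by simp⟩
  · rw [dif_neg hx, dif_neg (by simpa [h1, ht] using hx)]
    refine ⟨t ^ 2, pow_ne_zero _ ht, ?_, ?_, ?_⟩ <;> simp only [Matrix.cons_val, h0, h1, h2] <;> ring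

theorem isMorphism_chainToQuartic (hA : IsCubicChain A) (hB : IsFermatQuotient 2 2 B) :
    IsMorphism (Quotient.map (chainToQuartic hA hB) fun _ _ => chainToQuartic_equiv hA hB) := by
  obtain ⟨h0, h1, h2⟩ := isWeightedHomogeneous_three 1 1 1
  intro x
  have hx := hA.eq_zero x
  by_cases h : x.1 1 = 0 ∧ x.1 2 = 0
  -- Rescaling `(x₀x₁, x₁, x₂)` by `t = x₀² / x₂` and replacing `x₀²x₁ / x₂` by `-(x₁² + x₂²)`
  -- clears the denominators; the result is defined at `(1 : 0 : 0)`.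
  · refine ⟨2, ![C (-1) * (X 0 ^ 3 * X 2) + X 0 * X 1 * (X 1 ^ 2 + X 2 ^ 2),
      C (-1) * (X 1 ^ 2 + X 2 ^ 2), X 0 ^ 2], fun j => ?_, ?_, fun y hy => ?_⟩
    · rw [hA.weights_eq, hB.weights_eq]
      fin_cases j
      · exact (((h0.pow 3).mul h2).C_mul _).add ((h0.mul h1).mul ((h1.pow 2).add (h2.pow 2)))
      · exact ((h1.pow 2).add (h2.pow 2)).C_mul _
      · exact h0.pow 2
    · have hx0 : x.1 0 ≠ 0 := by simpa [h] using fin_three_ne_zero_iff.1 x.2.1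
      exact fin_three_ne_zero_iff.2 (Or.inr (Or.inr (by simpa using hx0)))
    · have hy' := hA.eq_zero y
      refine ⟨⟨_, hy, ?_⟩, rfl, Points.mk_eq_mk.2 ?_⟩
      · rw [hB.eval_eq]
        simp
        linear_combination (-y.1 0 ^ 2 *
          (y.1 0 ^ 2 * y.1 1 + y.1 1 ^ 2 * y.1 2 + y.1 2 ^ 3)) * hy'
      · rw [hB.weights_eq, weightedEquiv_three]
        unfold chainToQuartic
        rw [fin_three_ne_zero_iff] at hy
        by_cases hy12 : y.1 1 = 0 ∧ y.1 2 = 0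
        · rw [dif_pos hy12]
          have hy0 : y.1 0 ≠ 0 := by simpa [hy12] using fin_three_ne_zero_iff.1 y.2.1
          refine ⟨y.1 0 ^ 2, pow_ne_zero _ hy0, ?_, ?_, ?_⟩ <;> simp [hy12]
        · rw [dif_neg hy12]
          by_cases hy0 : y.1 0 = 0
          · have hy2 : y.1 2 = 0 := by
              simp [hy0] at hy
              rw [hy0] at hy'
              refine (mul_eq_zero_iff_right (b := y.1 1 ^ 2 + y.1 2 ^ 2) fun h => hy ?_).1 ?_
              · linear_combination -h
              · linear_combination hy'
            have hy1 : y.1 1 ≠ 0 := by tauto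
            refine ⟨-y.1 1, neg_ne_zero.2 hy1, ?_, ?_, ?_⟩ <;> simp [hy0, hy2]; ring
          · have hy2 : y.1 2 ≠ 0 := fun h2 => by
              rw [h2] at hy'
              simp_all
            refine ⟨y.1 0 ^ 2 / y.1 2, by simp [hy0, hy2], ?_, ?_, ?_⟩
            · simp
              field_simp
              linear_combination (y.1 1 * y.1 2 - y.1 0 ^ 2) * hy'
            · simp
              field_simp
              linear_combination -hy'
            · simp
              field_simp
  · refine ⟨1, ![X 0 * X 1, X 1, X 2], fun j => ?_, ?_, fun y hy => ?_⟩
    · rw [hA.weights_eq, hB.weights_eq]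
      fin_cases j
      exacts [h0.mul h1, h1, h2]
    · rw [fin_three_ne_zero_iff]
      simp
      tauto
    · have hy12 : ¬ (y.1 1 = 0 ∧ y.1 2 = 0) := by
        rw [fin_three_ne_zero_iff] at hy
        simp at hy
        tauto
      refine ⟨chainToQuartic hA hB y, ?_, rfl⟩
      rw [chainToQuartic, dif_neg hy12]
      funext j
      fin_cases j <;> simp

theorem isMorphism_quarticToChain (hB : IsFermatQuotient 2 2 B) (hA : IsCubicChain A) :
    IsMorphism (Quotient.map (quarticToChain hB hA) fun _ _ => quarticToChain_equiv hB hA) := by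
  obtain ⟨h0, h1, h2⟩ := isWeightedHomogeneous_three 2 1 1
  intro x
  have hx := hB.eq_zero x
  by_cases h : x.1 1 = 0
  · have hx0 : x.1 0 = 0 := by simpa [h] using hx
    have hx2 : x.1 2 ≠ 0 := by simpa [h, hx0] using fin_three_ne_zero_iff.1 x.2.1
    -- This is `(x₀, x₁², x₁x₂)` multiplied by `x₀ / x₁`, with `x₀² / x₁` replaced by `-(x₁²x₂ +
    -- x₂³)`.
    refine ⟨3, ![C (-1) * (X 1 ^ 2 * X 2 + X 2 ^ 3), X 1 * X 0, X 2 * X 0], fun j => ?_, ?_,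
      fun y hy => ?_⟩
    · rw [hA.weights_eq, hB.weights_eq]
      fin_cases j
      · exact (((h1.pow 2).mul h2).add (h2.pow 3)).C_mul _
      · exact h1.mul h0
      · exact h2.mul h0
    · exact fin_three_ne_zero_iff.2 (Or.inl (by simp [h, hx2]))
    · have hy' := hB.eq_zero y
      refine ⟨⟨_, hy, ?_⟩, rfl, Points.mk_eq_mk.2 ?_⟩
      · rw [hA.eval_eq]
        simp
        linear_combination (y.1 0 * (y.1 1 ^ 2 * y.1 2 + y.1 2 ^ 3)) * hy'
      · rw [hA.weights_eq, weightedEquiv_three]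
        unfold quarticToChain
        rw [fin_three_ne_zero_iff] at hy
        by_cases hy1 : y.1 1 = 0
        · rw [dif_pos hy1]
          have hy0 : y.1 0 = 0 := by simpa [hy1] using hy'
          refine ⟨-y.1 2 ^ 3, ?_, ?_, ?_, ?_⟩
          · simpa [hy1, hy0] using hy
          all_goals simp [hy1, hy0]
        · rw [dif_neg hy1]
          have hy0 : y.1 0 ≠ 0 := fun hy0 => by
            simp [hy0] at hy
            rw [hy0] at hy'
            refine hy (mul_left_cancel₀ hy1 ?_)
            linear_combination -hy'
          refine ⟨y.1 0 / y.1 1, div_ne_zero hy0 hy1, ?_, ?_, ?_⟩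
          · simp
            field_simp
            linear_combination -hy'
          · simp
            field_simp
          · simp
            field_simp
  · refine ⟨2, ![X 0, X 1 ^ 2, X 1 * X 2], fun j => ?_, ?_, fun y hy => ?_⟩
    · rw [hA.weights_eq, hB.weights_eq]
      fin_cases j
      exacts [h0, h1.pow 2, h1.mul h2]
    · exact fin_three_ne_zero_iff.2 (Or.inr (Or.inl (by simpa using h)))
    · have hy1 : y.1 1 ≠ 0 := fun hy1 => by
        have hy' := hB.eq_zero y
        simp [hy1] at hy'
        rw [fin_three_ne_zero_iff] at hy
        simp [hy1, hy'] at hy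
      refine ⟨quarticToChain hB hA y, ?_, rfl⟩
      rw [quarticToChain, dif_neg hy1]
      funext j
      fin_cases j <;> simp

/-- The curves `x₀² + x₁³x₂ + x₁x₂³ = 0` and `x₀²x₁ + x₁²x₂ + x₂³ = 0` are isomorphic. -/
theorem nonempty_iso_chain (hB : IsFermatQuotient 2 2 B) (hA : IsCubicChain A) :
    Nonempty (FunctionSpace.Iso (hypersurface B) (hypersurface A)) := by
  refine ⟨isoOfMorphisms _ _ (isMorphism_quarticToChain hB hA) (isMorphism_chainToQuartic hA hB)
    (fun q => ?_) (fun q => ?_)⟩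
  · obtain ⟨y, rfl⟩ := q.exists_rep
    refine Points.mk_eq_mk.2 ?_
    rw [hB.weights_eq, weightedEquiv_three]
    have hy' := hB.eq_zero y
    unfold quarticToChain
    by_cases hy1 : y.1 1 = 0
    · have hy0 : y.1 0 = 0 := by simpa [hy1] using hy'
      have hy2 : y.1 2 ≠ 0 := by simpa [hy1, hy0] using fin_three_ne_zero_iff.1 y.2.1
      rw [dif_pos hy1, chainToQuartic, dif_pos (by simp)]
      exact ⟨y.1 2, hy2, by simp [hy1, hy0]⟩
    · rw [dif_neg hy1, chainToQuartic, dif_neg (by simp [hy1])]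
      refine ⟨(y.1 1)⁻¹, inv_ne_zero hy1, ?_, ?_, ?_⟩ <;> simp <;> field_simp
  · obtain ⟨x, rfl⟩ := q.exists_rep
    refine Points.mk_eq_mk.2 ?_
    rw [hA.weights_eq, weightedEquiv_three]
    have hx' := hA.eq_zero x
    unfold chainToQuartic
    by_cases hx : x.1 1 = 0 ∧ x.1 2 = 0
    · have hx0 : x.1 0 ≠ 0 := by simpa [hx] using fin_three_ne_zero_iff.1 x.2.1
      rw [dif_pos hx, quarticToChain, dif_pos (by simp)]
      exact ⟨x.1 0, hx0, by simp [hx]⟩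
    · have hx1 : x.1 1 ≠ 0 := fun h => hx ⟨h, by simpa [h] using hx'⟩
      rw [dif_neg hx, quarticToChain, dif_neg (by simp [hx1])]
      refine ⟨(x.1 1)⁻¹, inv_ne_zero hx1, ?_, ?_, ?_⟩ <;> simp <;> field_simp

/-! ### Charges and weights -/

section Weights

variable {n : ℕ} {A : Matrix (Fin n) (Fin n) ℕ}

theorem sum_mul_charges (hA : (A.map (fun a => (a : ℚ))).det ≠ 0) (i : Fin n) :
    ∑ j, (A i j : ℚ) * charges A j = 1 := by
  have h : (A.map (fun a => (a : ℚ))).mulVec (charges A) = 1 := by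
    rw [charges, Matrix.mulVec_mulVec, Matrix.mul_nonsing_inv _ (isUnit_iff_ne_zero.2 hA),
      Matrix.one_mulVec]
  exact congrFun h i

theorem charges_eq (hA : (A.map (fun a => (a : ℚ))).det ≠ 0) {q : Fin n → ℚ}
    (hq : ∀ i, ∑ j, (A i j : ℚ) * q j = 1) : charges A = q := by
  have h : (A.map (fun a => (a : ℚ))).mulVec q = 1 := funext hq
  rw [charges, ← h, Matrix.mulVec_mulVec, Matrix.nonsing_inv_mul _ (isUnit_iff_ne_zero.2 hA),
    Matrix.one_mulVec]

theorem degree_pos (A : Matrix (Fin n) (Fin n) ℕ) : 0 < degree A := by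
  refine Nat.pos_of_ne_zero fun h => ?_
  obtain ⟨i, -, hi⟩ := Finset.lcm_eq_zero_iff.1 h
  exact (charges A i).den_nz hi

theorem cast_weights {i : Fin n} (hi : 0 < charges A i) :
    (weights A i : ℚ) = degree A * charges A i := by
  obtain ⟨m, hm⟩ : (charges A i).den ∣ degree A := Finset.dvd_lcm (Finset.mem_univ i)
  have h : (degree A : ℚ) * charges A i = ((m * (charges A i).num : ℤ) : ℚ) := by
    conv_lhs => rw [← Rat.num_div_den (charges A i), hm]
    push_cast
    field_simp
  rw [weights, h, Rat.num_intCast]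
  have h1 : 0 ≤ (m * (charges A i).num : ℤ) :=
    mul_nonneg (Int.natCast_nonneg m) (Rat.num_nonneg.2 hi.le)
  exact_mod_cast Int.toNat_of_nonneg h1

theorem IsCalabiYau.weights_pos (hA : IsCalabiYau A) (i : Fin n) : 0 < weights A i := by
  have h : (0 : ℚ) < weights A i := by
    rw [cast_weights (hA.charges_pos i)]
    exact mul_pos (Nat.cast_pos.2 (degree_pos A)) (hA.charges_pos i)
  exact_mod_cast h

theorem IsCalabiYau.sum_mul_weights (hA : IsCalabiYau A) (i : Fin n) :
    ∑ j, A i j * weights A j = degree A := by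
  have h : ((∑ j, A i j * weights A j : ℕ) : ℚ) = degree A := by
    push_cast
    simp only [cast_weights (hA.charges_pos _), mul_left_comm _ (degree A : ℚ)]
    rw [← Finset.mul_sum, sum_mul_charges hA.invertible, mul_one]
  exact_mod_cast h

theorem charges_submatrix (hA : (A.map (fun a => (a : ℚ))).det ≠ 0) (σ τ : Equiv.Perm (Fin n)) :
    charges (A.submatrix σ τ) = charges A ∘ τ := by
  refine charges_eq ?_ fun i => ?_
  · change (((A.map (fun a => (a : ℚ))).submatrix σ id).submatrix id τ).det ≠ 0
    rw [Matrix.det_permute', Matrix.det_permute]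
    simpa using hA
  · rw [← sum_mul_charges hA (σ i)]
    exact Equiv.sum_comp τ fun j => (A (σ i) j : ℚ) * charges A j

theorem degree_submatrix (hA : (A.map (fun a => (a : ℚ))).det ≠ 0) (σ τ : Equiv.Perm (Fin n)) :
    degree (A.submatrix σ τ) = degree A := by
  refine Nat.dvd_antisymm (Finset.lcm_dvd fun i _ => ?_) (Finset.lcm_dvd fun i _ => ?_)
  · rw [charges_submatrix hA]
    exact Finset.dvd_lcm (f := fun i => (charges A i).den) (Finset.mem_univ (τ i))
  · have := Finset.dvd_lcm (f := fun i => (charges (A.submatrix σ τ) i).den)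
      (Finset.mem_univ (τ.symm i))
    rwa [charges_submatrix hA, Function.comp_apply, Equiv.apply_symm_apply,
      ← charges_submatrix hA σ τ] at this

theorem weights_submatrix (hA : (A.map (fun a => (a : ℚ))).det ≠ 0) (σ τ : Equiv.Perm (Fin n))
    (i : Fin n) : weights (A.submatrix σ τ) i = weights A (τ i) := by
  rw [weights, degree_submatrix hA, charges_submatrix hA]
  rfl

theorem eval_potential (A : Matrix (Fin n) (Fin n) ℕ) (x : Fin n → ℂ) :
    eval x (potential A) = ∑ i, ∏ j, x j ^ A i j := by
  simp [potential]

theorem row_injective (hA : (A.map (fun a => (a : ℚ))).det ≠ 0) : Function.Injective A := by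
  intro i j hij
  by_contra hne
  refine hA (Matrix.det_zero_of_row_eq hne (funext fun l => ?_))
  simp [hij]

/-! ### The groups -/

/-- Equal rows would make the determinant vanish, so the monomials are distinct and invariance of
the sum can be read off coefficient by coefficient. -/
theorem mem_SL_iff (hA : (A.map (fun a => (a : ℚ))).det ≠ 0) {g : Fin n → ℂˣ} :
    g ∈ SL A ↔ (∀ i, ∏ j, g j ^ A i j = 1) ∧ ∏ j, g j = 1 := by
  have h : ∀ x : Fin n → ℂ, eval (diagMul g x) (potential A) =
      ∑ i, ((∏ j, g j ^ A i j : ℂˣ) : ℂ) * ∏ j, x j ^ A i j := fun x => by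
    simp [eval_potential, diagMul, mul_pow, Finset.prod_mul_distrib]
  refine and_congr_left fun _ => ⟨fun hg i => ?_, fun hg x => ?_⟩
  · let c : Fin n → ℂ := fun i => ((∏ j, g j ^ A i j : ℂˣ) : ℂ) - 1
    let P : MvPolynomial (Fin n) ℂ := ∑ i, monomial (Finsupp.equivFunOnFinite.symm (A i)) (c i)
    have hP : P = 0 := MvPolynomial.funext fun x => by
      have := hg x
      rw [h, eval_potential] at this
      simp only [P, map_sum, eval_monomial, map_zero]
      rw [← sub_eq_zero.2 this, ← Finset.sum_sub_distrib]
      refine Finset.sum_congr rfl fun i _ => ?_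
      rw [Finsupp.prod_fintype _ _ (by simp)]
      simp [c, sub_mul]
    have h1 := congrArg (coeff (Finsupp.equivFunOnFinite.symm (A i))) hP
    simp only [P, coeff_sum, coeff_monomial, EmbeddingLike.apply_eq_iff_eq,
      (row_injective hA).eq_iff, Finset.sum_ite_eq', Finset.mem_univ, if_true, coeff_zero, c] at h1
    exact Units.ext (sub_eq_zero.1 h1)
  · rw [h, eval_potential]
    simp [hg]

/-- The vector with all coordinates one already determines a scaling factor `t`. -/
theorem mem_J_iff {g : SL A} : g ∈ J A ↔ ∃ t : ℂˣ, ∀ i, g.1 i = t ^ weights A i := by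
  constructor
  · intro hg
    rcases isEmpty_or_nonempty (Fin n) with h | ⟨⟨i₀⟩⟩
    · exact ⟨1, fun i => isEmptyElim i⟩
    · obtain ⟨t, ht⟩ := hg 1 (Function.ne_iff.2 ⟨i₀, one_ne_zero⟩)
      exact ⟨t, fun i => Units.ext (by simpa [diagMul] using ht i)⟩
  · rintro ⟨t, ht⟩ x -
    exact ⟨t, fun i => by simp [diagMul, ht i]⟩

/-- The map `t ↦ (t ^ w_i)` identifies the `d`-th roots of unity with `J_W`: its determinant is `t ^
d` because the weights add up to `d`, and a weight one makes it injective. -/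
theorem IsCalabiYau.card_J (hA : IsCalabiYau A) {i : Fin n} (hi : weights A i = 1) :
    Nat.card (J A) = degree A := by
  have : NeZero (degree A) := ⟨(degree_pos A).ne'⟩
  have h : ∀ t : ℂˣ, t ^ degree A = 1 → (fun i => t ^ weights A i) ∈ SL A := fun t ht => by
    refine (mem_SL_iff hA.invertible).2 ⟨fun i => ?_, ?_⟩
    · rw [← ht, ← hA.sum_mul_weights i, ← Finset.prod_pow_eq_pow_sum]
      exact Finset.prod_congr rfl fun j _ => by rw [← pow_mul, mul_comm]
    · rw [Finset.prod_pow_eq_pow_sum, hA.calabiYau, ht]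
  let f : rootsOfUnity (degree A) ℂ → J A := fun t =>
    ⟨⟨_, h t.1 ((mem_rootsOfUnity _ _).1 t.2)⟩, mem_J_iff.2 ⟨t.1, fun _ => rfl⟩⟩
  have hf : Function.Bijective f := by
    constructor
    · intro s t hst
      have := congrFun (congrArg (fun g : J A => g.1.1) hst) i
      simpa [f, hi] using this
    · rintro ⟨g, hg⟩
      obtain ⟨t, ht⟩ := mem_J_iff.1 hg
      refine ⟨⟨t, (mem_rootsOfUnity _ _).2 ?_⟩, Subtype.ext (Subtype.ext (funext fun i =>
        (ht i).symm))⟩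
      have h1 := g.2.2
      rwa [Finset.prod_congr rfl fun i _ => ht i, Finset.prod_pow_eq_pow_sum, hA.calabiYau] at h1
  rw [← Nat.card_eq_of_bijective f hf, Complex.card_rootsOfUnity]

end Weights

/-! ### The table -/

theorem det_table_ne_zero (k : Fin 13) : ((table k).map (fun a => (a : ℚ))).det ≠ 0 := by
  fin_cases k <;> simp [table, Matrix.det_fin_three]
  all_goals norm_num

/-- The charge `1 / d` of the last variable has denominator exactly `d`, which gives minimality of
`d`. -/
theorem weights_of_charges {A : Matrix (Fin 3) (Fin 3) ℕ} {w : Fin 3 → ℕ} {d : ℕ} (hd : d ≠ 0)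
    (hw : w 2 = 1) (h : ∀ i, charges A i = w i / d) : degree A = d ∧ weights A = w := by
  have hd' : (d : ℚ) ≠ 0 := Nat.cast_ne_zero.2 hd
  have h1 : degree A = d := by
    refine Nat.dvd_antisymm (Finset.lcm_dvd fun i _ => ?_) ?_
    · rw [h, ← Int.cast_natCast (w i), ← Int.cast_natCast d, ← Rat.divInt_eq_div,
        ← Int.natCast_dvd_natCast]
      exact Rat.den_dvd _ _
    · have h2 := Finset.dvd_lcm (f := fun i => (charges A i).den) (Finset.mem_univ 2)
      rw [h, hw, Nat.cast_one, one_div, Rat.inv_natCast_den, if_neg hd] at h2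
      exact h2
  refine ⟨h1, funext fun i => ?_⟩
  rw [weights, h1, h, mul_div_cancel₀ _ hd', Rat.num_natCast, Int.toNat_natCast]

theorem charges_table (k : Fin 13) (i : Fin 3) :
    charges (table k) i = tableWeights k i / (∑ j, tableWeights k j : ℕ) := by
  have h : ∀ k i, ∑ j, table k i j * tableWeights k j = ∑ j, tableWeights k j := by decide
  have h' : (∑ j, tableWeights k j : ℕ) ≠ 0 := by revert k; decide
  rw [charges_eq (q := fun i => tableWeights k i / (∑ j, tableWeights k j : ℕ))
    (det_table_ne_zero k)]
  intro i
  simp only [← mul_div_assoc, ← Finset.sum_div]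
  rw [div_eq_one_iff_eq (Nat.cast_ne_zero.2 h'), ← h k i]
  push_cast
  rfl

theorem weights_table (k : Fin 13) :
    degree (table k) = ∑ j, tableWeights k j ∧ weights (table k) = tableWeights k :=
  weights_of_charges (by revert k; decide) (by revert k; decide) (charges_table k)

theorem nondegenerate_table (k : Fin 13) (x : Fin 3 → ℂ)
    (h : ∀ i, eval x (pderiv i (potential (table k))) = 0) : x = 0 := by
  have h0 := h 0
  have h1 := h 1
  have h2 := h 2
  clear h
  suffices x 0 = 0 ∧ x 1 = 0 ∧ x 2 = 0 by
    funext i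
    fin_cases i
    exacts [this.1, this.2.1, this.2.2]
  revert h0 h1 h2
  fin_cases k <;> simp [potential, table, Fin.sum_univ_three, Fin.prod_univ_three, pderiv_X]
  all_goals generalize x 0 = a
  all_goals generalize x 1 = b
  all_goals generalize x 2 = c
  · tauto
  · grind
  · intro h0 h1 h2
    -- Multiplying `c² = -2ab`, `a² = -2bc` and `b² = -2ca` gives `(abc)² = -8(abc)²`.
    have h3 : a * b * c = 0 := by
      have : (a * b * c) ^ 2 = 0 := by
        linear_combination (a ^ 2 * b ^ 2 * h0 - 2 * a * b * (b ^ 2 * h1 - 2 * b * c * h2)) / 9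
      exact pow_eq_zero_iff two_ne_zero |>.1 this
    grind
  · grind
  · grind
  · tauto
  · grind
  · grind
  · grind
  · grind
  · tauto
  · grind
  · grind

/-! ### The classification -/

section Rows

variable {n : ℕ} {A : Matrix (Fin n) (Fin n) ℕ}

theorem potential_eq_sum_monomial (A : Matrix (Fin n) (Fin n) ℕ) :
    potential A = ∑ i, monomial (Finsupp.equivFunOnFinite.symm (A i)) 1 := by
  refine Finset.sum_congr rfl fun i _ => ?_
  rw [monomial_eq, Finsupp.prod_fintype _ _ (by simp)]
  simp

theorem eval_pderiv_potential (A : Matrix (Fin n) (Fin n) ℕ) (x : Fin n → ℂ) (l : Fin n) :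
    eval x (pderiv l (potential A)) =
      ∑ i, (A i l : ℂ) * ∏ j, x j ^ (A i j - if j = l then 1 else 0) := by
  simp only [potential_eq_sum_monomial, map_sum, pderiv_monomial, eval_monomial]
  refine Finset.sum_congr rfl fun i _ => ?_
  rw [Finsupp.prod_fintype _ _ (by simp)]
  simp [Finsupp.single_apply, eq_comm]

/-- For every variable, some monomial is a power of it, up to a further linear factor. -/
theorem exists_row (hA : ∀ x : Fin n → ℂ, x ≠ 0 → eval x (potential A) = 0 →
    ∃ i, eval x (pderiv i (potential A)) ≠ 0) (j : Fin n) :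
    ∃ i, (∀ l, l ≠ j → A i l = 0) ∨ ∃ l, l ≠ j ∧ A i l = 1 ∧ ∀ m, m ≠ j → m ≠ l → A i m = 0 := by
  by_contra! h
  -- At the `j`-th coordinate point a monomial contributes to `W` only if it is a power of `x_j`,
  -- and to a partial derivative only if at most one further linear factor occurs.
  have hx : (Pi.single j 1 : Fin n → ℂ) ≠ 0 := by simp
  obtain ⟨l, hl⟩ := hA _ hx (by
    rw [eval_potential]
    refine Finset.sum_eq_zero fun i _ => ?_
    obtain ⟨⟨l, hlj, hl⟩, -⟩ := h i
    exact Finset.prod_eq_zero (Finset.mem_univ l) (by simp [hlj, hl]))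
  rw [eval_pderiv_potential] at hl
  obtain ⟨i, -, hi⟩ := Finset.exists_ne_zero_of_sum_ne_zero hl
  obtain ⟨hi, hi'⟩ := mul_ne_zero_iff.1 hi
  rw [Finset.prod_ne_zero_iff] at hi'
  have h1 : ∀ m, m ≠ j → A i m - (if m = l then 1 else 0) = 0 := fun m hm => by
    simpa [hm] using hi' m (Finset.mem_univ m)
  have h2 : A i l ≠ 0 := by simpa using hi
  have hlj : l ≠ j := by
    rintro rfl
    obtain ⟨⟨m, hm, hm'⟩, -⟩ := h i
    have := h1 m hm
    rw [if_neg hm] at this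
    exact hm' this
  have h3 := h1 l hlj
  rw [if_pos rfl] at h3
  obtain ⟨m, hm, hml, hm'⟩ := (h i).2 l hlj (by lia)
  have h4 := h1 m hm
  rw [if_neg hml] at h4
  exact hm' h4

end Rows

theorem sum_three {M : Type*} [AddCommMonoid M] {j l k : Fin 3} (hjl : j ≠ l) (hjk : j ≠ k)
    (hlk : l ≠ k) (f : Fin 3 → M) : ∑ i, f i = f j + f l + f k := by
  have h : (Finset.univ : Finset (Fin 3)) = {j, l, k} := by revert j l k; decide
  rw [h, Finset.sum_insert (by simp [hjl, hjk]), Finset.sum_pair hlk, add_assoc]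

theorem exists_third (j l : Fin 3) : ∃ m, m ≠ j ∧ m ≠ l := by
  revert j l
  decide

theorem eq_or_eq_of_ne {j l k i : Fin 3} (hjl : j ≠ l) (hjk : j ≠ k) (hlk : l ≠ k) (hi : i ≠ j) :
    i = l ∨ i = k := by
  revert j l k i
  decide

/-- The combinatorial conditions on the matrix of exponents of an admissible potential, with the
monomials listed in the order of the variables. -/
structure IsInvertibleType (C : Matrix (Fin 3) (Fin 3) ℕ) (w : Fin 3 → ℕ) : Prop where
  two_le : ∀ j, 2 ≤ C j j
  row : ∀ j, (∀ l, l ≠ j → C j l = 0) ∨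
    ∃ l, l ≠ j ∧ C j l = 1 ∧ ∀ m, m ≠ j → m ≠ l → C j m = 0
  not_pointing : ∀ j l k, j ≠ l → j ≠ k → l ≠ k → ¬ (C j k = 1 ∧ C l k = 1)
  sum_eq : ∀ j, ∑ l, C j l * w l = ∑ l, w l

theorem IsInvertibleType.submatrix {C : Matrix (Fin 3) (Fin 3) ℕ} {w : Fin 3 → ℕ}
    (h : IsInvertibleType C w) (τ : Equiv.Perm (Fin 3)) :
    IsInvertibleType (C.submatrix τ τ) (w ∘ τ) where
  two_le j := h.two_le (τ j)
  row j := by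
    refine (h.row (τ j)).imp (fun h1 l hl => h1 (τ l) (τ.injective.ne hl)) ?_
    rintro ⟨l, hl, h1, h2⟩
    refine ⟨τ.symm l, fun h => hl (by rw [← h, τ.apply_symm_apply]), by simpa using h1,
      fun m hm hm' => h2 (τ m) (τ.injective.ne hm) fun h => hm' (by rw [← h, τ.symm_apply_apply])⟩
  not_pointing j l k hjl hjk hlk := h.not_pointing (τ j) (τ l) (τ k) (τ.injective.ne hjl)
    (τ.injective.ne hjk) (τ.injective.ne hlk)
  sum_eq j := by
    have h1 := h.sum_eq (τ j)
    rw [← Equiv.sum_comp τ, ← Equiv.sum_comp τ w] at h1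
    exact h1

theorem IsCalabiYau.exists_isInvertibleType {A : Matrix (Fin 3) (Fin 3) ℕ} (hA : IsCalabiYau A) :
    ∃ ρ : Equiv.Perm (Fin 3), IsInvertibleType (A.submatrix ρ id) (weights A) := by
  choose ρ hρ using exists_row hA.nondegenerate
  have hw := hA.weights_pos
  have hsum : ∀ i, ∑ l, A i l * weights A l = ∑ l, weights A l := fun i => by
    rw [hA.sum_mul_weights, hA.calabiYau]
  -- With exponent at most one the degree would be at most the sum of two weights, less than the sum
  -- of all three.
  have htwo : ∀ j, 2 ≤ A (ρ j) j := fun j => by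
    by_contra! h
    have h1 : A (ρ j) j * weights A j ≤ weights A j :=
      (Nat.mul_le_mul_right _ (Nat.le_of_lt_succ h)).trans_eq (one_mul _)
    obtain ⟨l, hlj⟩ : ∃ l, l ≠ j := exists_ne j
    rcases hρ j with h2 | ⟨l, hlj, h2, h3⟩
    · obtain ⟨m, hm⟩ : ∃ m, m ≠ j ∧ m ≠ l := exists_third j l
      have h4 := hsum (ρ j)
      rw [sum_three hlj.symm hm.1.symm hm.2.symm, sum_three hlj.symm hm.1.symm hm.2.symm,
        h2 l hlj, h2 m hm.1] at h4
      have := hw l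
      lia
    · obtain ⟨m, hm⟩ : ∃ m, m ≠ j ∧ m ≠ l := exists_third j l
      have h4 := hsum (ρ j)
      rw [sum_three hlj.symm hm.1.symm hm.2.symm, sum_three hlj.symm hm.1.symm hm.2.symm,
        h2, h3 m hm.1 hm.2] at h4
      have := hw m
      lia
  -- Away from its own variable a row has entries at most one, so it cannot serve two variables.
  have hinj : Function.Injective ρ := fun j j' h => by
    by_contra hne
    have h1 := htwo j'
    rw [← h] at h1
    rcases hρ j with h2 | ⟨l, hlj, h2, h3⟩
    · rw [h2 j' (Ne.symm hne)] at h1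
      lia
    · by_cases hl : j' = l
      · rw [hl, h2] at h1
        lia
      · rw [h3 j' (Ne.symm hne) hl] at h1
        lia
  refine ⟨Equiv.ofBijective ρ (Finite.injective_iff_bijective.1 hinj), htwo, hρ, ?_,
    fun j => hsum (ρ j)⟩
  rintro j l k hjl hjk hlk ⟨hj, hl⟩
  replace hj : A (ρ j) k = 1 := hj
  replace hl : A (ρ l) k = 1 := hl
  have hother : ∀ {i i' : Fin 3}, i ≠ k → i' ≠ k → i ≠ i' → A (ρ i) k = 1 → A (ρ i) i' = 0 :=
    fun {i i'} hi hi' hii' h => by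
      rcases hρ i with h1 | ⟨m, hm, h1, h2⟩
      · exact h1 i' hii'.symm
      · by_cases hmk : k = m
        · exact h2 i' hii'.symm fun h => hi' (h.trans hmk.symm)
        · rw [h2 k hi.symm hmk] at h
          exact absurd h zero_ne_one
  have hjl0 := hother hjk hlk hjl hj
  have hlj0 := hother hlk hjk hjl.symm hl
  have hkk := htwo k
  -- If `j` and `l` both pointed to `k`, then on `x_k = 0` the potential and its derivatives in
  -- `x_j, x_l` would vanish, and the derivative in `x_k` would be `x_j ^ a + x_l ^ b`. The point
  -- `x_j = z`, `x_l = 1` with `z ^ a = -1` is singular.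
  obtain ⟨z, hz⟩ := IsAlgClosed.exists_pow_nat_eq (-1 : ℂ) (n := A (ρ j) j)
    (by have := htwo j; lia)
  let x : Fin 3 → ℂ := fun i => if i = j then z else if i = l then 1 else 0
  have hxj : x j = z := if_pos rfl
  have hxl : x l = 1 := by simp [x, hjl.symm]
  have hxk : x k = 0 := by simp [x, hjk.symm, hlk.symm]
  have hsum' : ∀ f : Fin 3 → ℂ, ∑ i, f i = f (ρ j) + f (ρ l) + f (ρ k) :=
    sum_three (hinj.ne hjl) (hinj.ne hjk) (hinj.ne hlk)
  have hzero : ∀ f : Fin 3 → ℕ, f k ≠ 0 → ∏ m, x m ^ f m = 0 := fun f hf =>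
    Finset.prod_eq_zero (Finset.mem_univ k) (by rw [hxk, zero_pow hf])
  obtain ⟨i, hi⟩ := hA.nondegenerate x (Function.ne_iff.2 ⟨l, by simp [hxl]⟩) (by
    rw [eval_potential, hsum', hzero _ (by lia), hzero _ (by lia), hzero _ (by lia)]
    simp)
  refine hi ?_
  rw [eval_pderiv_potential, hsum', hzero (fun m => A (ρ k) m - _) (by split_ifs <;> lia)]
  by_cases hik : k = i
  · subst hik
    have hprod : ∀ f : Fin 3 → ℂ, ∏ i, f i = f j * f l * f k :=
      fun f => sum_three (M := Additive ℂ) hjl hjk hlk f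
    simp [hprod, hxj, hxl, hxk, hj, hl, hjl0, hlj0, hz, hjk, hlk]
  · rw [hzero (fun m => A (ρ j) m - _) (by rw [if_neg hik]; lia),
      hzero (fun m => A (ρ l) m - _) (by rw [if_neg hik]; lia)]
    simp

/-- Writing `b + c = ma` with `a` largest gives `m ≤ 2`. If `m = 2` all three are equal, hence one;
if `m = 1` then `b ∣ 2c`, so `b ∣ 2` by coprimality. -/
theorem weights_eq_of_dvd {a b c : ℕ} (ha : 0 < a) (hb : 0 < b) (hc : 0 < c) (hab : a.Coprime b)
    (hac : a.Coprime c) (hbc : b.Coprime c) (hcb : c ≤ b) (hba : b ≤ a) (h1 : a ∣ b + c)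
    (h2 : b ∣ a + c) :
    (a = 1 ∧ b = 1 ∧ c = 1) ∨ (a = 2 ∧ b = 1 ∧ c = 1) ∨ (a = 3 ∧ b = 2 ∧ c = 1) := by
  obtain ⟨m, hm⟩ := h1
  have hm2 : m ≤ 2 := by
    by_contra! h
    have := Nat.mul_le_mul_left a h
    lia
  have hm0 : m ≠ 0 := by rintro rfl; lia
  obtain rfl | rfl : m = 1 ∨ m = 2 := by lia
  · have h3 : b ∣ 2 * c := by
      have : a + c = b + 2 * c := by lia
      rw [this] at h2
      exact (Nat.dvd_add_right dvd_rfl).1 h2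
    have h4 : b ∣ 2 := hbc.dvd_of_dvd_mul_right h3
    obtain rfl | rfl := (Nat.dvd_prime Nat.prime_two).1 h4
    · lia
    · obtain rfl | rfl : c = 1 ∨ c = 2 := by lia
      · lia
      · simp at hbc
  · have h3 : a = b := by lia
    have h4 : a = c := by lia
    subst h3
    rw [Nat.coprime_self] at hab
    lia

theorem IsInvertibleType.row_cases {C : Matrix (Fin 3) (Fin 3) ℕ} {w : Fin 3 → ℕ}
    (h : IsInvertibleType C w) {j l k : Fin 3} (hjl : j ≠ l) (hjk : j ≠ k) (hlk : l ≠ k) :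
    (C j l = 0 ∧ C j k = 0) ∨ (C j l = 1 ∧ C j k = 0) ∨ (C j l = 0 ∧ C j k = 1) := by
  rcases h.row j with h4 | ⟨i, hi, h5, h6⟩
  · exact Or.inl ⟨h4 l hjl.symm, h4 k hjk.symm⟩
  · obtain rfl | rfl : i = l ∨ i = k := eq_or_eq_of_ne hjl hjk hlk hi
    · exact Or.inr (Or.inl ⟨h5, h6 k hjk.symm hlk.symm⟩)
    · exact Or.inr (Or.inr ⟨h6 l hjl.symm hlk, h5⟩)

/-- Cancelling one `w j` from the degree equation of row `j` leaves `w l + w k` for a pure power. If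
`j` points to another variable, `w j` divides the remaining weight and is therefore one. -/
theorem IsInvertibleType.dvd {C : Matrix (Fin 3) (Fin 3) ℕ} {w : Fin 3 → ℕ}
    (h : IsInvertibleType C w) {j l k : Fin 3} (hjl : j ≠ l) (hjk : j ≠ k) (hlk : l ≠ k)
    (hl : (w j).Coprime (w l)) (hk : (w j).Coprime (w k)) : w j ∣ w l + w k := by
  have h1 := h.sum_eq j
  rw [sum_three hjl hjk hlk, sum_three hjl hjk hlk] at h1
  have h2 := h.two_le j
  obtain ⟨m, hm⟩ : ∃ m, C j j = m + 1 := ⟨C j j - 1, by lia⟩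
  rw [hm] at h1
  have h3 : w j * m + C j l * w l + C j k * w k = w l + w k := by
    have : (m + 1) * w j = w j * m + w j := by ring
    lia
  have h4 := h.row_cases hjl hjk hlk
  rcases h4 with ⟨e, e'⟩ | ⟨e, e'⟩ | ⟨e, e'⟩ <;> rw [e, e'] at h3
  · exact ⟨m, by lia⟩
  · have : w j ∣ w k := ⟨m, by lia⟩
    rw [Nat.eq_one_of_dvd_coprimes hk dvd_rfl this]
    exact one_dvd _
  · have : w j ∣ w l := ⟨m, by lia⟩
    rw [Nat.eq_one_of_dvd_coprimes hl dvd_rfl this]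
    exact one_dvd _

theorem SameUpToRenaming.trans {n : ℕ} {A B C : Matrix (Fin n) (Fin n) ℕ}
    (h : SameUpToRenaming A B) (h' : SameUpToRenaming B C) : SameUpToRenaming A C := by
  obtain ⟨σ, τ, rfl⟩ := h
  obtain ⟨σ', τ', rfl⟩ := h'
  exact ⟨σ'.trans σ, τ'.trans τ, rfl⟩

theorem SameUpToRenaming.symm {n : ℕ} {A B : Matrix (Fin n) (Fin n) ℕ}
    (h : SameUpToRenaming A B) : SameUpToRenaming B A := by
  obtain ⟨σ, τ, rfl⟩ := h
  exact ⟨σ.symm, τ.symm, by ext; simp⟩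

instance {n : ℕ} (A B : Matrix (Fin n) (Fin n) ℕ) : Decidable (SameUpToRenaming A B) :=
  inferInstanceAs (Decidable (∃ σ τ : Equiv.Perm (Fin n), A.submatrix σ τ = B))

theorem mirror_table (k : Fin 13) : SameUpToRenaming (table k).transpose (table (mirror k)) := by
  revert k
  decide +kernel

theorem table_injective {k l : Fin 13} (h : SameUpToRenaming (table k) (table l)) : k = l := by
  revert k l
  decide +kernel

/-- Once the weights and the off-diagonal entries of a row are fixed, the degree equation determines
the diagonal entry, so only finitely many matrices are left to compare. -/
theorem IsInvertibleType.exists_table_of_weights {C : Matrix (Fin 3) (Fin 3) ℕ} {w : Fin 3 → ℕ}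
    (h : IsInvertibleType C w) (hw : (w 0 = 1 ∧ w 1 = 1 ∧ w 2 = 1) ∨
      (w 0 = 2 ∧ w 1 = 1 ∧ w 2 = 1) ∨ (w 0 = 3 ∧ w 1 = 2 ∧ w 2 = 1)) :
    ∃ k, SameUpToRenaming C (table k) := by
  have r0 := h.row_cases (j := 0) (l := 1) (k := 2) (by decide) (by decide) (by decide)
  have r1 := h.row_cases (j := 1) (l := 0) (k := 2) (by decide) (by decide) (by decide)
  have r2 := h.row_cases (j := 2) (l := 0) (k := 1) (by decide) (by decide) (by decide)
  have n0 := h.not_pointing 1 2 0 (by decide) (by decide) (by decide)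
  have n1 := h.not_pointing 0 2 1 (by decide) (by decide) (by decide)
  have n2 := h.not_pointing 0 1 2 (by decide) (by decide) (by decide)
  have s0 := h.sum_eq 0
  have s1 := h.sum_eq 1
  have s2 := h.sum_eq 2
  rw [Fin.sum_univ_three, Fin.sum_univ_three] at s0 s1 s2
  rw [Matrix.eta_fin_three C]
  generalize C 0 0 = a00 at *
  generalize C 0 1 = a01 at *
  generalize C 0 2 = a02 at *
  generalize C 1 0 = a10 at *
  generalize C 1 1 = a11 at *
  generalize C 1 2 = a12 at *
  generalize C 2 0 = a20 at *
  generalize C 2 1 = a21 at *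
  generalize C 2 2 = a22 at *
  clear h
  rcases hw with ⟨e0, e1, e2⟩ | ⟨e0, e1, e2⟩ | ⟨e0, e1, e2⟩ <;> rw [e0, e1, e2] at s0 s1 s2
  · have r0' : (a00 = 3 ∧ a01 = 0 ∧ a02 = 0) ∨ (a00 = 2 ∧ a01 = 1 ∧ a02 = 0) ∨
        (a00 = 2 ∧ a01 = 0 ∧ a02 = 1) := by
      clear n0 n1 n2 r1 r2 s1 s2
      rcases r0 with ⟨rfl, rfl⟩ | ⟨rfl, rfl⟩ | ⟨rfl, rfl⟩ <;> omega
    have r1' : (a10 = 0 ∧ a11 = 3 ∧ a12 = 0) ∨ (a10 = 1 ∧ a11 = 2 ∧ a12 = 0) ∨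
        (a10 = 0 ∧ a11 = 2 ∧ a12 = 1) := by
      clear n0 n1 n2 r0 r2 s0 s2
      rcases r1 with ⟨rfl, rfl⟩ | ⟨rfl, rfl⟩ | ⟨rfl, rfl⟩ <;> omega
    have r2' : (a20 = 0 ∧ a21 = 0 ∧ a22 = 3) ∨ (a20 = 1 ∧ a21 = 0 ∧ a22 = 2) ∨
        (a20 = 0 ∧ a21 = 1 ∧ a22 = 2) := by
      clear n0 n1 n2 r0 r1 s0 s1
      rcases r2 with ⟨rfl, rfl⟩ | ⟨rfl, rfl⟩ | ⟨rfl, rfl⟩ <;> omega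
    clear r0 r1 r2 s0 s1 s2 e0 e1 e2
    rcases r0' with ⟨rfl, rfl, rfl⟩ | ⟨rfl, rfl, rfl⟩ | ⟨rfl, rfl, rfl⟩ <;>
    rcases r1' with ⟨rfl, rfl, rfl⟩ | ⟨rfl, rfl, rfl⟩ | ⟨rfl, rfl, rfl⟩ <;>
    rcases r2' with ⟨rfl, rfl, rfl⟩ | ⟨rfl, rfl, rfl⟩ | ⟨rfl, rfl, rfl⟩ <;>
    first
    | exact absurd ⟨rfl, rfl⟩ n0
    | exact absurd ⟨rfl, rfl⟩ n1
    | exact absurd ⟨rfl, rfl⟩ n2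
    | decide +kernel
  · have r0' : a00 = 2 ∧ a01 = 0 ∧ a02 = 0 := by
      clear n0 n1 n2 r1 r2 s1 s2
      rcases r0 with ⟨rfl, rfl⟩ | ⟨rfl, rfl⟩ | ⟨rfl, rfl⟩ <;> omega
    have r1' : (a10 = 0 ∧ a11 = 4 ∧ a12 = 0) ∨ (a10 = 1 ∧ a11 = 2 ∧ a12 = 0) ∨
        (a10 = 0 ∧ a11 = 3 ∧ a12 = 1) := by
      clear n0 n1 n2 r0 r2 s0 s2
      rcases r1 with ⟨rfl, rfl⟩ | ⟨rfl, rfl⟩ | ⟨rfl, rfl⟩ <;> omega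
    have r2' : (a20 = 0 ∧ a21 = 0 ∧ a22 = 4) ∨ (a20 = 1 ∧ a21 = 0 ∧ a22 = 2) ∨
        (a20 = 0 ∧ a21 = 1 ∧ a22 = 3) := by
      clear n0 n1 n2 r0 r1 s0 s1
      rcases r2 with ⟨rfl, rfl⟩ | ⟨rfl, rfl⟩ | ⟨rfl, rfl⟩ <;> omega
    clear r0 r1 r2 s0 s1 s2 e0 e1 e2
    obtain ⟨rfl, rfl, rfl⟩ := r0'
    rcases r1' with ⟨rfl, rfl, rfl⟩ | ⟨rfl, rfl, rfl⟩ | ⟨rfl, rfl, rfl⟩ <;>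
    rcases r2' with ⟨rfl, rfl, rfl⟩ | ⟨rfl, rfl, rfl⟩ | ⟨rfl, rfl, rfl⟩ <;>
    first
    | exact absurd ⟨rfl, rfl⟩ n0
    | decide +kernel
  · have r0' : a00 = 2 ∧ a01 = 0 ∧ a02 = 0 := by
      clear n0 n1 n2 r1 r2 s1 s2
      rcases r0 with ⟨rfl, rfl⟩ | ⟨rfl, rfl⟩ | ⟨rfl, rfl⟩ <;> omega
    have r1' : a10 = 0 ∧ a11 = 3 ∧ a12 = 0 := by
      clear n0 n1 n2 r0 r2 s0 s2
      rcases r1 with ⟨rfl, rfl⟩ | ⟨rfl, rfl⟩ | ⟨rfl, rfl⟩ <;> omega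
    have r2' : (a20 = 0 ∧ a21 = 0 ∧ a22 = 6) ∨ (a20 = 1 ∧ a21 = 0 ∧ a22 = 3) ∨
        (a20 = 0 ∧ a21 = 1 ∧ a22 = 4) := by
      clear n0 n1 n2 r0 r1 s0 s1
      rcases r2 with ⟨rfl, rfl⟩ | ⟨rfl, rfl⟩ | ⟨rfl, rfl⟩ <;> omega
    clear r0 r1 r2 s0 s1 s2 e0 e1 e2
    obtain ⟨rfl, rfl, rfl⟩ := r0'
    obtain ⟨rfl, rfl, rfl⟩ := r1'
    rcases r2' with ⟨rfl, rfl, rfl⟩ | ⟨rfl, rfl, rfl⟩ | ⟨rfl, rfl, rfl⟩ <;> decide +kernel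

theorem IsCalabiYau.coprime_weights {A : Matrix (Fin 3) (Fin 3) ℕ} (hA : IsCalabiYau A)
    {j l : Fin 3} (h : j ≠ l) : (weights A j).Coprime (weights A l) := by
  obtain ⟨i, hij, hil⟩ := exists_third j l
  refine Nat.dvd_one.1 ?_
  rw [← hA.normalized i]
  refine Finset.dvd_gcd fun m hm => ?_
  obtain rfl | rfl := eq_or_eq_of_ne hij hil h (Finset.ne_of_mem_erase hm)
  exacts [Nat.gcd_dvd_left _ _, Nat.gcd_dvd_right _ _]

theorem IsCalabiYau.exists_table {A : Matrix (Fin 3) (Fin 3) ℕ} (hA : IsCalabiYau A) :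
    ∃ k, SameUpToRenaming A (table k) := by
  obtain ⟨ρ, hρ⟩ := hA.exists_isInvertibleType
  -- Composition with the reversal makes the weights decreasing, as in the table.
  let τ : Equiv.Perm (Fin 3) := Fin.revPerm.trans (Tuple.sort (weights A))
  have hanti : ∀ {i j : Fin 3}, i ≤ j → weights A (τ j) ≤ weights A (τ i) := fun {i j} h =>
    Tuple.monotone_sort (weights A) (Fin.rev_le_rev.2 h)
  have hτ := hρ.submatrix τ
  have hcop : ∀ {i j : Fin 3}, i ≠ j → (weights A (τ i)).Coprime (weights A (τ j)) := fun h =>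
    hA.coprime_weights (τ.injective.ne h)
  obtain ⟨k, hk⟩ := hτ.exists_table_of_weights (weights_eq_of_dvd
    (hA.weights_pos _) (hA.weights_pos _) (hA.weights_pos _) (hcop (by decide)) (hcop (by decide))
    (hcop (by decide)) (hanti (by decide)) (hanti (by decide))
    (hτ.dvd (by decide) (by decide) (by decide) (hcop (by decide)) (hcop (by decide)))
    (hτ.dvd (by decide) (by decide) (by decide) (hcop (by decide)) (hcop (by decide))))
  exact ⟨k, SameUpToRenaming.trans ⟨τ.trans ρ, τ, rfl⟩ hk⟩

/-! ### The groups of the thirteen potentials -/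

theorem isCalabiYau_table (k : Fin 13) : IsCalabiYau (table k) where
  invertible := det_table_ne_zero k
  charges_pos i := by
    have h : ∀ k i, 0 < tableWeights k i := by decide
    rw [charges_table]
    exact div_pos (Nat.cast_pos.2 (h k i))
      (Nat.cast_pos.2 (Finset.sum_pos (fun j _ => h k j) Finset.univ_nonempty))
  normalized := by
    rw [(weights_table k).2]
    revert k
    decide
  nondegenerate x hx _ := by
    by_contra! h
    exact hx (nondegenerate_table k x h)
  calabiYau := by rw [(weights_table k).1, (weights_table k).2]

theorem card_J_table (k : Fin 13) : Nat.card (J (table k)) = tableJ k := by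
  have h : weights (table k) 2 = 1 := by
    rw [(weights_table k).2]
    revert k
    decide
  rw [(isCalabiYau_table k).card_J h, (weights_table k).1]
  clear h
  revert k
  decide

/-- The invariance of the monomials and the determinant condition leave only `g 2` free; thus every
element of `SL(W)` is a weighted scaling. -/
theorem eq_pow_tableWeights {k : Fin 13} (hk0 : k ≠ 0) (hk5 : k ≠ 5) {g : Fin 3 → ℂˣ}
    (hg : g ∈ SL (table k)) (i : Fin 3) : g i = g 2 ^ tableWeights k i := by
  rw [mem_SL_iff (det_table_ne_zero k)] at hg
  obtain ⟨hrow, hprod⟩ := hg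
  have h0 := congrArg (Units.val : ℂˣ → ℂ) (hrow 0)
  have h1 := congrArg (Units.val : ℂˣ → ℂ) (hrow 1)
  have h2 := congrArg (Units.val : ℂˣ → ℂ) (hrow 2)
  have h3 := congrArg (Units.val : ℂˣ → ℂ) hprod
  clear hrow hprod
  rw [Fin.prod_univ_three] at h0 h1 h2 h3
  push_cast at h0 h1 h2 h3
  have hg : ∀ i, (g i : ℂ) = ![(g 0 : ℂ), g 1, g 2] i := fun i => by fin_cases i <;> rfl
  refine Units.ext ?_
  push_cast
  rw [hg i]
  clear hg
  generalize (g 0 : ℂ) = a at *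
  generalize (g 1 : ℂ) = b at *
  generalize (g 2 : ℂ) = c at *
  revert h0 h1 h2 h3
  fin_cases k <;> fin_cases i <;> simp [table, tableWeights] at hk0 hk5 ⊢
  all_goals grind

theorem J_table_eq_top {k : Fin 13} (hk0 : k ≠ 0) (hk5 : k ≠ 5) : J (table k) = ⊤ := by
  refine eq_top_iff.2 fun g _ => mem_J_iff.2 ⟨g.1 2, fun i => ?_⟩
  rw [(weights_table k).2]
  exact eq_pow_tableWeights hk0 hk5 g.2 i

theorem card_SLt_of_J_eq_top {n : ℕ} {A : Matrix (Fin n) (Fin n) ℕ} (h : J A = ⊤) :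
    Nat.card (SLt A) = 1 :=
  Subgroup.index_eq_one.2 h

theorem card_SL {n : ℕ} (A : Matrix (Fin n) (Fin n) ℕ) :
    Nat.card (SL A) = Nat.card (SLt A) * Nat.card (J A) :=
  Subgroup.card_eq_card_quotient_mul_card_subgroup (J A)

/-! ### The group of `x₀ᵖ + x₁ᵖᵏ + x₂ᵖᵏ` -/

section Fermat

variable {p k : ℕ} [NeZero p] {A : Matrix (Fin 3) (Fin 3) ℕ}

theorem IsFermat.mem_SL_iff (hA : IsFermat p k A) (hpk : p * k = k + 2) {g : Fin 3 → ℂˣ} :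
    g ∈ SL A ↔ g 0 ^ p = 1 ∧ g 1 ^ (p * k) = 1 ∧ g 2 ^ (p * k) = 1 ∧ g 0 * g 1 * g 2 = 1 := by
  have hp := NeZero.ne p
  have hpk' : p * k ≠ 0 := by lia
  constructor
  · rintro ⟨h, h'⟩
    have h0 := h ![1, 0, 0]
    have h1 := h ![0, 1, 0]
    have h2 := h ![0, 0, 1]
    simp only [hA.eval_eq, diagMul, Matrix.cons_val, mul_one, mul_zero, zero_pow hp,
      zero_pow hpk', one_pow, add_zero, zero_add] at h0 h1 h2
    rw [Fin.prod_univ_three] at h'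
    exact ⟨Units.ext (by simpa using h0), Units.ext (by simpa using h1),
      Units.ext (by simpa using h2), h'⟩
  · rintro ⟨h0, h1, h2, h3⟩
    have h0' : (g 0 : ℂ) ^ p = 1 := by rw [← Units.val_pow_eq_pow_val, h0, Units.val_one]
    have h1' : (g 1 : ℂ) ^ (p * k) = 1 := by rw [← Units.val_pow_eq_pow_val, h1, Units.val_one]
    have h2' : (g 2 : ℂ) ^ (p * k) = 1 := by rw [← Units.val_pow_eq_pow_val, h2, Units.val_one]
    refine ⟨fun x => ?_, by rw [Fin.prod_univ_three, h3]⟩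
    simp only [hA.eval_eq, diagMul, mul_pow, h0', h1', h2', one_mul]

/-- Every element of `SL(W)` is, up to scaling, of the form `(μ⁻¹, μ, 1)`. -/
theorem IsFermat.exists_eq (hA : IsFermat p k A) (hpk : p * k = k + 2) {g : Fin 3 → ℂˣ}
    (hg : g ∈ SL A) : ∃ μ : ℂˣ, μ ^ p = 1 ∧ g 0 = g 2 ^ k * μ⁻¹ ∧ g 1 = g 2 * μ := by
  obtain ⟨h0, h1, h2, h3⟩ := (hA.mem_SL_iff hpk).1 hg
  have h4 : g 0 = (g 1)⁻¹ * (g 2)⁻¹ := by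
    rw [← mul_inv, eq_inv_iff_mul_eq_one, ← mul_assoc, h3]
  have h5 : g 2 ^ k * g 2 * g 2 = 1 := by
    rw [← h2, hpk, pow_add, pow_two, mul_assoc]
  refine ⟨g 1 * (g 2)⁻¹, ?_, ?_, by simp⟩
  · obtain ⟨q, rfl⟩ : ∃ q, p = q + 1 := ⟨p - 1, by have := NeZero.ne p; lia⟩
    have h6 : g 1 ^ (q + 1) * g 2 ^ (q + 1) = 1 := by
      rw [h4, mul_pow, inv_pow, inv_pow, ← mul_inv] at h0
      exact inv_eq_one.1 h0
    have h7 : g 2 ^ (q + 1) * g 2 ^ (q + 1) = 1 := by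
      -- From `pk = k + 2` it follows that `(p - 1)k = 2`, so `2p` is a multiple of `pk`, the
      -- exponent that kills `g 2`.
      have hq : (q + 1) + (q + 1) = (q + 1) * k * q := by
        have : q * k = 2 := by lia
        rw [mul_assoc, mul_comm k, this]
        ring
      rw [← pow_add, hq, pow_mul, h2, one_pow]
    rw [mul_pow, inv_pow, ← h6, mul_right_inj, inv_eq_iff_mul_eq_one, h7]
  · rw [h4, mul_inv, inv_inv, mul_left_comm, mul_right_inj, inv_eq_iff_mul_eq_one, mul_comm, h5]

theorem IsFermat.exists_smul_iff (hA : IsFermat p k A) (hpk : p * k = k + 2) (x y : Cone A) :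
    (∃ g : SL A, Points.mk (coneMap g x) = Points.mk y) ↔
      ∃ χ : AddChar (ZMod p) ℂ, Points.mk (coneCharMul hA χ x) = Points.mk y := by
  constructor
  · rintro ⟨g, hg⟩
    obtain ⟨μ, hμ, h0, h1⟩ := hA.exists_eq hpk g.2
    have hμ' : (μ : ℂ) ^ p = 1 := by rw [← Units.val_pow_eq_pow_val, hμ, Units.val_one]
    refine ⟨AddChar.zmodChar p hμ', ?_⟩
    rw [← hg, Points.mk_eq_mk, hA.weights_eq, weightedEquiv_three]
    have hχ : AddChar.zmodChar p hμ' 1 = μ := by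
      simpa using AddChar.zmodChar_apply' hμ' 1
    refine ⟨g.1 2, (g.1 2).ne_zero, ?_, ?_, ?_⟩ <;>
      simp [coneMap, diagMul, coneCharMul, charMul_eq, hχ, h0, h1, mul_assoc]
  · rintro ⟨χ, hχ⟩
    have h1 := addChar_pow_eq_one χ 1
    obtain ⟨μ, hμ⟩ := IsUnit.of_pow_eq_one h1 (NeZero.ne p)
    have hμ' : μ ^ p = 1 := Units.ext (by simpa [hμ] using h1)
    refine ⟨⟨![μ⁻¹, μ, 1], (hA.mem_SL_iff hpk).2 (by simp [hμ', pow_mul])⟩, ?_⟩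
    rw [← hχ]
    refine congrArg Points.mk (Subtype.ext ?_)
    rw [coneCharMul_val, charMul_eq]
    funext i
    fin_cases i <;> simp [coneMap, diagMul, hμ]

/-- The quotient by `SL(W) / J_W`. -/
theorem IsFermat.nonempty_iso_quotient {B : Matrix (Fin 3) (Fin 3) ℕ} (hA : IsFermat p k A)
    (hB : IsFermatQuotient p k B) (hpk : p * k = k + 2) :
    Nonempty (FunctionSpace.Iso ((hypersurface A).quotient (SLt A)) (hypersurface B)) := by
  refine ⟨fermatQuotientIso hA hB hpk (SLt A) fun x y => ?_⟩
  rw [← hA.exists_smul_iff hpk]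
  constructor
  · rintro ⟨g, hg⟩
    obtain ⟨g, rfl⟩ := QuotientGroup.mk_surjective g
    exact ⟨g, hg⟩
  · rintro ⟨g, hg⟩
    exact ⟨QuotientGroup.mk g, hg⟩

theorem IsFermat.nonempty_iso_quotient_of_eq_top {B : Matrix (Fin 3) (Fin 3) ℕ}
    (hA : IsFermat p k A) (hB : IsFermatQuotient p k B) (hpk : p * k = k + 2)
    {H : Subgroup (SLt A)} (hH : H = ⊤) :
    Nonempty (FunctionSpace.Iso ((hypersurface A).quotient H) (hypersurface B)) := by
  refine ⟨fermatQuotientIso hA hB hpk H fun x y => ?_⟩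
  rw [← hA.exists_smul_iff hpk]
  constructor
  · rintro ⟨⟨g, hg'⟩, hg⟩
    obtain ⟨g, rfl⟩ := QuotientGroup.mk_surjective g
    exact ⟨g, hg⟩
  · rintro ⟨g, hg⟩
    exact ⟨⟨QuotientGroup.mk g, hH ▸ Subgroup.mem_top _⟩, hg⟩

end Fermat

/-! ### Generators for Nos. 1 and 6, and the group orders -/

theorem isFermat_table_zero : IsFermat 3 1 (table 0) where
  weights_eq := (weights_table 0).2
  eval_eq x := by simp [eval_potential, table, Fin.sum_univ_three, Fin.prod_univ_three]

theorem isFermat_table_five : IsFermat 2 2 (table 5) where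
  weights_eq := (weights_table 5).2
  eval_eq x := by simp [eval_potential, table, Fin.sum_univ_three, Fin.prod_univ_three]

theorem isFermatQuotient_table_four : IsFermatQuotient 3 1 (table 4) where
  weights_eq := (weights_table 4).2
  eval_eq x := by simp [eval_potential, table, Fin.sum_univ_three, Fin.prod_univ_three]

theorem isFermatQuotient_table_nine : IsFermatQuotient 2 2 (table 9) where
  weights_eq := (weights_table 9).2
  eval_eq x := by simp [eval_potential, table, Fin.sum_univ_three, Fin.prod_univ_three]

theorem isCubicChain_table_one : IsCubicChain (table 1) where
  weights_eq := (weights_table 1).2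
  eval_eq x := by simp [eval_potential, table, Fin.sum_univ_three, Fin.prod_univ_three]

/-- Modulo `J_W` every element is some `(μ⁻¹, μ, 1)`, so it suffices that powers of `φ` reach each
of these up to a weighted scaling by `t`. -/
theorem IsFermat.zpowers_eq_top {p k : ℕ} [NeZero p] {A : Matrix (Fin 3) (Fin 3) ℕ}
    (hA : IsFermat p k A) (hpk : p * k = k + 2) {φ : SL A}
    (hφ : ∀ μ : ℂˣ, μ ^ p = 1 → ∃ (j : ℕ) (t : ℂˣ),
      φ.1 0 ^ j = t ^ k * μ⁻¹ ∧ φ.1 1 ^ j = t * μ ∧ φ.1 2 ^ j = t) :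
    Subgroup.zpowers (QuotientGroup.mk φ : SLt A) = ⊤ := by
  refine eq_top_iff.2 fun g _ => ?_
  obtain ⟨g, rfl⟩ := QuotientGroup.mk_surjective g
  obtain ⟨μ, hμ, h0, h1⟩ := hA.exists_eq hpk g.2
  obtain ⟨j, t, e0, e1, e2⟩ := hφ μ hμ
  refine Subgroup.mem_zpowers_iff.2 ⟨j, ?_⟩
  rw [zpow_natCast, ← QuotientGroup.mk_pow, QuotientGroup.eq, mem_J_iff]
  refine ⟨t⁻¹ * g.1 2, fun i => ?_⟩
  rw [hA.weights_eq]
  fin_cases i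
  · simp [e0, h0, mul_pow]
    exact mul_left_comm _ _ _ |>.trans (by simp [mul_comm])
  · simp [e1, h1]
    exact mul_left_comm _ _ _ |>.trans (by simp [mul_comm])
  · simp [e2]

theorem exists_pow_eq_of_isPrimitiveRoot {p : ℕ} [NeZero p] {ζ μ : ℂˣ} (hζ : IsPrimitiveRoot ζ p)
    (hμ : μ ^ p = 1) : ∃ j : ℕ, ζ ^ j = μ := by
  obtain ⟨j, -, hj⟩ := (IsPrimitiveRoot.coe_units_iff.2 hζ).eq_pow_of_pow_eq_one
    (ξ := (μ : ℂ)) (by rw [← Units.val_pow_eq_pow_val, hμ, Units.val_one])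
  exact ⟨j, Units.ext (by simpa using hj)⟩

theorem exists_generator_table_zero {ζ : ℂˣ} (hζ : IsPrimitiveRoot ζ 3) :
    ∃ φ : SL (table 0), (φ : Fin 3 → ℂˣ) = ![ζ ^ 2, ζ, 1] ∧
      Subgroup.zpowers (QuotientGroup.mk φ : SLt (table 0)) = ⊤ ∧
      orderOf (QuotientGroup.mk φ : SLt (table 0)) = 3 := by
  have h3 : ζ ^ 3 = 1 := hζ.pow_eq_one
  have h6 : ζ ^ 6 = 1 := hζ.pow_eq_one_iff_dvd 6 |>.2 (by norm_num)
  have hmem : ![ζ ^ 2, ζ, 1] ∈ SL (table 0) :=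
    (isFermat_table_zero.mem_SL_iff rfl).2 (by simp [h3, h6, ← pow_mul, ← pow_succ])
  refine ⟨⟨_, hmem⟩, rfl, isFermat_table_zero.zpowers_eq_top rfl fun μ hμ => ?_, ?_⟩
  · obtain ⟨j, rfl⟩ := exists_pow_eq_of_isPrimitiveRoot hζ hμ
    refine ⟨j, 1, ?_, by simp, by simp⟩
    have : ζ ^ 2 = ζ⁻¹ := by rw [eq_inv_iff_mul_eq_one, ← pow_succ, h3]
    simp [this]
  · have : Fact (Nat.Prime 3) := ⟨Nat.prime_three⟩
    refine orderOf_eq_prime ?_ ?_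
    · rw [← QuotientGroup.mk_pow, QuotientGroup.eq_one_iff, mem_J_iff]
      refine ⟨1, fun i => ?_⟩
      fin_cases i <;> simp [h3, h6, ← pow_mul]
    · rw [Ne, QuotientGroup.eq_one_iff, mem_J_iff]
      rintro ⟨t, ht⟩
      rw [(weights_table 0).2] at ht
      have h1 : ζ = t ^ 1 := ht 1
      have h2 : 1 = t ^ 1 := ht 2
      exact hζ.ne_one (by norm_num) (h1.trans h2.symm)

theorem exists_generator_table_five :
    ∃ ι : SL (table 5), (ι : Fin 3 → ℂˣ) = ![-1, 1, -1] ∧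
      Subgroup.zpowers (QuotientGroup.mk ι : SLt (table 5)) = ⊤ ∧
      orderOf (QuotientGroup.mk ι : SLt (table 5)) = 2 := by
  have hmem : ![-1, 1, -1] ∈ SL (table 5) :=
    (isFermat_table_five.mem_SL_iff rfl).2 (by simp [Even.neg_pow (show Even 4 by decide)])
  refine ⟨⟨_, hmem⟩, rfl, isFermat_table_five.zpowers_eq_top rfl fun μ hμ => ?_, ?_⟩
  · obtain rfl | rfl : μ = 1 ∨ μ = -1 := by
      have h1 : ((μ : ℂ) - 1) * ((μ : ℂ) - -1) = 0 := by
        have h2 := congrArg (Units.val : ℂˣ → ℂ) hμ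
        push_cast at h2
        linear_combination h2
      exact (mul_eq_zero.1 h1).imp (fun h => Units.ext (sub_eq_zero.1 h))
        fun h => Units.ext (by simpa using sub_eq_zero.1 h)
    · exact ⟨0, 1, by simp⟩
    -- `diag(-1, 1, -1)` is `(μ⁻¹, μ, 1)` for `μ = -1`, scaled by `t = -1`, which acts trivially on
    -- the coordinate of weight two.
    · exact ⟨1, -1, by simp⟩
  · refine orderOf_eq_prime ?_ ?_
    · rw [← QuotientGroup.mk_pow, QuotientGroup.eq_one_iff, mem_J_iff]
      refine ⟨1, fun i => ?_⟩
      fin_cases i <;> simp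
    · rw [Ne, QuotientGroup.eq_one_iff, mem_J_iff]
      rintro ⟨t, ht⟩
      rw [(weights_table 5).2] at ht
      have h1 : 1 = t ^ 1 := ht 1
      have h2 : -1 = t ^ 1 := ht 2
      have h3 := congrArg (Units.val : ℂˣ → ℂ) (h2.trans h1.symm)
      norm_num at h3

theorem card_SLt_table (k : Fin 13) : Nat.card (SLt (table k)) = tableSLt k := by
  by_cases hk0 : k = 0
  · subst hk0
    have h := Complex.isPrimitiveRoot_exp 3 (by norm_num)
    have hu := h.isUnit (by norm_num)
    obtain ⟨φ, -, h1, h2⟩ := exists_generator_table_zero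
      (ζ := hu.unit) (IsPrimitiveRoot.coe_units_iff.1 (by simpa using h))
    rw [← orderOf_eq_card_of_zpowers_eq_top h1, h2]
    rfl
  · by_cases hk5 : k = 5
    · subst hk5
      obtain ⟨ι, -, h1, h2⟩ := exists_generator_table_five
      rw [← orderOf_eq_card_of_zpowers_eq_top h1, h2]
      rfl
    · rw [card_SLt_of_J_eq_top (J_table_eq_top hk0 hk5)]
      revert k
      decide

theorem card_SL_table (k : Fin 13) : Nat.card (SL (table k)) = tableSL k := by
  rw [card_SL, card_SLt_table, card_J_table]
  revert k
  decide

/-! ### Potentials of the form `x₀² + f(x₁, x₂)` -/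

/-- The monomials of `W` are distinct with coefficient one, and `x₀²` is the only monomial on the
right that involves `x₀`. -/
theorem exists_row_of_potential_eq {A : Matrix (Fin 3) (Fin 3) ℕ}
    (hA : (A.map (fun a => (a : ℚ))).det ≠ 0) {f : MvPolynomial (Fin 2) ℂ}
    (hf : potential A = X 0 ^ 2 + rename Fin.succ f) :
    ∃ r, A r = ![2, 0, 0] ∧ ∀ i, i ≠ r → A i 0 = 0 := by
  classical
  let e : (Fin 3 → ℕ) → (Fin 3 →₀ ℕ) := Finsupp.equivFunOnFinite.symm
  have h1 : ∀ a : Fin 3 → ℕ, coeff (e a) (potential A) = ∑ i, if A i = a then 1 else 0 :=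
    fun a => by simp [potential_eq_sum_monomial, coeff_sum, coeff_monomial, e]
  have h2 : ∀ a : Fin 3 → ℕ, a 0 ≠ 0 → coeff (e a) (potential A) =
      if a = ![2, 0, 0] then 1 else 0 := fun a ha => by
    rw [hf, coeff_add, coeff_rename_eq_zero, add_zero, coeff_X_pow]
    · have : (Finsupp.single 0 2 : Fin 3 →₀ ℕ) = e ![2, 0, 0] := by
        ext i
        fin_cases i <;> simp [e]
      rw [this]
      simp only [e, EmbeddingLike.apply_eq_iff_eq, eq_comm]
    · intro u hu
      refine absurd ?_ ha
      have h3 := DFunLike.congr_fun hu 0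
      rw [Finsupp.mapDomain_of_notMem_range _ _ (by simp)] at h3
      exact h3.symm
  have h3 : ∀ i, A i 0 ≠ 0 → A i = ![2, 0, 0] := fun i hi => by
    by_contra hne
    have h4 := h2 (A i) hi
    rw [if_neg hne, h1] at h4
    simp [(row_injective hA).eq_iff] at h4
  obtain ⟨r, hr⟩ : ∃ r, A r = ![2, 0, 0] := by
    by_contra! hne
    have h4 := h2 ![2, 0, 0] (by simp)
    rw [if_pos rfl, h1] at h4
    simp [hne] at h4
  refine ⟨r, hr, fun i hi => ?_⟩
  by_contra h
  exact hi (row_injective hA ((h3 i h).trans hr.symm))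

theorem eval_potential_submatrix {n : ℕ} (A : Matrix (Fin n) (Fin n) ℕ)
    (σ τ : Equiv.Perm (Fin n)) (x : Fin n → ℂ) :
    eval (x ∘ τ) (potential (A.submatrix σ τ)) = eval x (potential A) := by
  rw [eval_potential, eval_potential]
  exact (Finset.sum_congr rfl fun i _ => Equiv.prod_comp τ fun j => x j ^ A (σ i) j).trans
    (Equiv.sum_comp σ fun i => ∏ j, x j ^ A i j)

theorem J_eq_top_of_submatrix {n : ℕ} {A : Matrix (Fin n) (Fin n) ℕ}
    (hA : (A.map (fun a => (a : ℚ))).det ≠ 0) {σ τ : Equiv.Perm (Fin n)}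
    (h : J (A.submatrix σ τ) = ⊤) : J A = ⊤ := by
  refine eq_top_iff.2 fun g _ => mem_J_iff.2 ?_
  have hg : (g.1 ∘ τ) ∈ SL (A.submatrix σ τ) := by
    refine ⟨fun x => ?_, (Equiv.prod_comp τ g.1).trans g.2.2⟩
    have h1 := g.2.1 (x ∘ τ.symm)
    rw [← eval_potential_submatrix A σ τ, ← eval_potential_submatrix A σ τ (x ∘ τ.symm)] at h1
    have h2 : diagMul g.1 (x ∘ τ.symm) ∘ τ = diagMul (g.1 ∘ τ) x := by
      funext i
      simp [diagMul]
    have h3 : (x ∘ τ.symm) ∘ τ = x := by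
      funext i
      simp
    rwa [h2, h3] at h1
  obtain ⟨t, ht⟩ := mem_J_iff.1 (h ▸ Subgroup.mem_top (⟨_, hg⟩ : SL (A.submatrix σ τ)))
  refine ⟨t, fun i => ?_⟩
  have h1 := ht (τ.symm i)
  rw [weights_submatrix hA, Equiv.apply_symm_apply] at h1
  rw [← h1]
  simp

theorem nonempty_iso_quotient_of_J_eq_top {n : ℕ} {A : Matrix (Fin n) (Fin n) ℕ} (h : J A = ⊤) :
    Nonempty (FunctionSpace.Iso ((hypersurface A).quotient (SLt A)) (hypersurface A)) := by
  refine ⟨quotientIso (X := hypersurface A) (Y := hypersurface A) (SLt A) id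
    Function.surjective_id (fun x y => ?_) continuous_id (fun U hU => hU) fun U f => Iff.rfl⟩
  have h1 : ∀ g : SLt A, g = 1 := fun g => by
    obtain ⟨g, rfl⟩ := QuotientGroup.mk_surjective g
    exact (QuotientGroup.eq_one_iff g).2 (h ▸ Subgroup.mem_top g)
  constructor
  · rintro ⟨g, rfl⟩
    rw [h1 g, one_smul]
  · rintro rfl
    exact ⟨1, one_smul _ _⟩

/-- An isolated square excludes No. 1, and in No. 6 it can only be the square of the variable of
weight two. This ensures that a renaming to No. 6 fixes `x₀`. -/
theorem table_eq_of_row {k : Fin 13} {r c : Fin 3} (h : table k r c = 2)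
    (hr : ∀ j, j ≠ c → table k r j = 0) (hc : ∀ i, i ≠ r → table k i c = 0) :
    k ≠ 0 ∧ (k ≠ 5 ∨ c = 0) := by
  have key : ∀ x : Fin 13 × Fin 3 × Fin 3, table x.1 x.2.1 x.2.2 = 2 →
      (∀ j, j ≠ x.2.2 → table x.1 x.2.1 j = 0) → (∀ i, i ≠ x.2.1 → table x.1 i x.2.2 = 0) →
      x.1 ≠ 0 ∧ (x.1 ≠ 5 ∨ x.2.2 = 0) := by decide +kernel
  exact key (k, r, c) h hr hc

theorem isFermat_of_submatrix {A : Matrix (Fin 3) (Fin 3) ℕ} (hA : IsCalabiYau A)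
    {σ τ : Equiv.Perm (Fin 3)} (h : A.submatrix σ τ = table 5) (hτ : τ 0 = 0) :
    IsFermat 2 2 A := by
  have h' : (τ 1 = 1 ∧ τ 2 = 2) ∨ (τ 1 = 2 ∧ τ 2 = 1) := by
    clear h
    revert τ
    decide
  have hw : ∀ i, weights A (τ i) = ![2, 1, 1] i := fun i => by
    rw [← weights_submatrix hA.invertible σ τ, h, isFermat_table_five.weights_eq]
  constructor
  · have h0 := hw 0
    have h1 := hw 1
    have h2 := hw 2
    funext i
    rcases h' with ⟨e1, e2⟩ | ⟨e1, e2⟩ <;> rw [hτ] at h0 <;> rw [e1] at h1 <;> rw [e2] at h2 <;>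
      fin_cases i <;> simp [h0, h1, h2]
  · intro x
    rw [← eval_potential_submatrix A σ τ, h, isFermat_table_five.eval_eq]
    rcases h' with ⟨e1, e2⟩ | ⟨e1, e2⟩ <;> simp only [Function.comp_apply, hτ, e1, e2]
    ring

/-- The quotient of `x₀² + f(x₁, x₂) = 0` by `SL(W) / J_W`. -/
theorem nonempty_iso_quotient_of_potential_eq {A : Matrix (Fin 3) (Fin 3) ℕ} (hA : IsCalabiYau A)
    {f : MvPolynomial (Fin 2) ℂ} (hf : potential A = X 0 ^ 2 + rename Fin.succ f) :
    Nonempty (FunctionSpace.Iso ((hypersurface A).quotient (SLt A)) (hypersurface A)) := by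
  obtain ⟨r, hr, hc⟩ := exists_row_of_potential_eq hA.invertible hf
  obtain ⟨k, σ, τ, h⟩ := hA.exists_table
  have hkij : ∀ i j, table k i j = A (σ i) (τ j) := fun i j => by rw [← h]; rfl
  obtain ⟨hk0, hk5⟩ := table_eq_of_row (k := k) (r := σ.symm r) (c := τ.symm 0)
    (by simp [hkij, hr]) (fun j hj => by
      have h1 : τ j ≠ 0 := fun h2 => hj (by rw [← h2, τ.symm_apply_apply])
      have h3 : ∀ i : Fin 3, i ≠ 0 → (![2, 0, 0] : Fin 3 → ℕ) i = 0 := by decide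
      simp [hkij, hr, h3 _ h1])
    (fun i hi => by
      have h1 : σ i ≠ r := fun h2 => hi (by rw [← h2, σ.symm_apply_apply])
      simp [hkij, hc _ h1])
  -- No. 6 has quotient No. 10, which is again isomorphic to No. 6; in all other cases the group is
  -- trivial.
  by_cases hk : k = 5
  · subst hk
    have hA' := isFermat_of_submatrix hA h (by
      have h1 := congrArg τ (hk5.resolve_left (not_not.2 rfl))
      rw [τ.apply_symm_apply] at h1
      exact h1.symm)
    obtain ⟨a⟩ := hA'.nonempty_iso_quotient isFermatQuotient_table_nine rfl
    obtain ⟨b⟩ := nonempty_iso_fermat isFermatQuotient_table_nine hA'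
    exact ⟨a.trans b⟩
  · refine nonempty_iso_quotient_of_J_eq_top (J_eq_top_of_submatrix hA.invertible (σ := σ) (τ := τ) ?_)
    rw [h]
    exact J_table_eq_top hk0 hk

end Delsarte

/-! ### The theorem -/

theorem mainTheorem8 :
    -- the quotient of `E : x_0 ^ 2 + f(x_1, x_2) = 0` by `SL(W) / J_W` is isomorphic to `E`
    (∀ A : Matrix (Fin 3) (Fin 3) ℕ, Delsarte.IsCalabiYau A →
      (∃ f : MvPolynomial (Fin 2) ℂ,
        Delsarte.potential A = MvPolynomial.X 0 ^ 2 + MvPolynomial.rename Fin.succ f) →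
      Nonempty (Delsarte.FunctionSpace.Iso
        ((Delsarte.hypersurface A).quotient (Delsarte.SLt A)) (Delsarte.hypersurface A))) ∧
    -- the thirteen potentials, their weights and the orders of their groups
    (∀ k : Fin 13, Delsarte.IsCalabiYau (Delsarte.table k) ∧
      Delsarte.weights (Delsarte.table k) = Delsarte.tableWeights k ∧
      Nat.card (Delsarte.J (Delsarte.table k)) = Delsarte.tableJ k ∧
      Nat.card (Delsarte.SL (Delsarte.table k)) = Delsarte.tableSL k ∧
      Nat.card (Delsarte.SLt (Delsarte.table k)) = Delsarte.tableSLt k) ∧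
    -- the classification
    (∀ A : Matrix (Fin 3) (Fin 3) ℕ, Delsarte.IsCalabiYau A →
      ∃! k : Fin 13, Delsarte.SameUpToRenaming A (Delsarte.table k)) ∧
    -- the mirrors
    (∀ k : Fin 13, Delsarte.SameUpToRenaming (Delsarte.table k).transpose
      (Delsarte.table (Delsarte.mirror k))) ∧
    -- number 1
    (∀ ζ : ℂˣ, IsPrimitiveRoot ζ 3 →
      ∃ φ : Delsarte.SL (Delsarte.table 0), (φ : Fin 3 → ℂˣ) = ![ζ ^ 2, ζ, 1] ∧
        Subgroup.zpowers (QuotientGroup.mk φ : Delsarte.SLt (Delsarte.table 0)) = ⊤ ∧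
        Nonempty (Delsarte.FunctionSpace.Iso
          ((Delsarte.hypersurface (Delsarte.table 0)).quotient
            (Subgroup.zpowers (QuotientGroup.mk φ : Delsarte.SLt (Delsarte.table 0))))
          (Delsarte.hypersurface (Delsarte.table 4)))) ∧
    -- number 6
    (∃ ι : Delsarte.SL (Delsarte.table 5), (ι : Fin 3 → ℂˣ) = ![-1, 1, -1] ∧
        Subgroup.zpowers (QuotientGroup.mk ι : Delsarte.SLt (Delsarte.table 5)) = ⊤ ∧
        Nonempty (Delsarte.FunctionSpace.Iso
          ((Delsarte.hypersurface (Delsarte.table 5)).quotient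
            (Subgroup.zpowers (QuotientGroup.mk ι : Delsarte.SLt (Delsarte.table 5))))
          (Delsarte.hypersurface (Delsarte.table 1)))) := by
  refine ⟨fun A hA ⟨f, hf⟩ => Delsarte.nonempty_iso_quotient_of_potential_eq hA hf,
    fun k => ⟨Delsarte.isCalabiYau_table k, (Delsarte.weights_table k).2, Delsarte.card_J_table k,
      Delsarte.card_SL_table k, Delsarte.card_SLt_table k⟩, fun A hA => ?_, Delsarte.mirror_table,
    fun ζ hζ => ?_, ?_⟩
  · obtain ⟨k, hk⟩ := hA.exists_table
    exact ⟨k, hk, fun l hl => Delsarte.table_injective (hl.symm.trans hk)⟩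
  · obtain ⟨φ, hφ, h, -⟩ := Delsarte.exists_generator_table_zero hζ
    exact ⟨φ, hφ, h, Delsarte.isFermat_table_zero.nonempty_iso_quotient_of_eq_top
      Delsarte.isFermatQuotient_table_four rfl h⟩
  · obtain ⟨ι, hι, h, -⟩ := Delsarte.exists_generator_table_five
    obtain ⟨a⟩ := Delsarte.isFermat_table_five.nonempty_iso_quotient_of_eq_top
      Delsarte.isFermatQuotient_table_nine rfl h
    obtain ⟨b⟩ := Delsarte.nonempty_iso_chain Delsarte.isFermatQuotient_table_nine
      Delsarte.isCubicChain_table_one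
    exact ⟨ι, hι, h, ⟨a.trans b⟩⟩
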